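/- Let $(X,\mathcal A,\mu)$ be a $\sigma$-finite measure space and $T:X\to X$ a conservative, ergodic, measure-preserving transformation. For measurable $u\ge 0$ let $\mu_u(B)=\int_B u\,d\mu$, and let $\hat T u=d(\mu_u\circ T^{-1})/d\mu$ be the transfer operator. A family $\mathfrak H$ of non-negative measurable functions is *uniformly sweeping* for a non-negative measurable function $G$ if there are $C>0$ and $K\in\{0,1,2,\dots\}$ such that $C\sum_{k=0}^K\hat T^kH\ge G$ a.e. for all $H\in\mathfrak H$; a single function $H$ is uniformly sweeping for $G$ if $\{H\}$ is. For $A\in\mathcal A$ put $S_n^A(x)=\sum_{k=1}^n 1_A(T^kx)$. For $Y\in\mathcal A$ put $Y_0=Y$, $Y_n=T^{-n}Y\setminus\bigcup_{k=0}^{n-1}T^{-k}Y$ $(n\ge1)$ and $w_n^{Y,A}=\mu\big(\bigcup_{k=0}^{n-1}(T^{-k}Y)\cap A\big)$. Suppose: (C1) $X=Y\cup\bigcup_{i=1}^dA_i$ for some $d\ge2$ and some pairwise disjoint $Y,A_1,\dots,A_d\in\mathcal A$ with $0<\mu(Y)<\infty$ and $\mu(A_i)=\infty$ for all $i$, and $Y$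 dynamically separates $A_1,\dots,A_d$, that is, $A_i\cap T^{-1}A_j=\emptyset$ whenever $i\ne j$. (C2) There are $\alpha,\beta_1,\dots,\beta_d\in(0,1)$ with $\sum_{i=1}^d\beta_i=1$ and a positive measurable function $\ell:(0,\infty)\to(0,\infty)$, slowly varying at $\infty$ (i.e. $\ell(rt)/\ell(t)\to1$ as $t\to\infty$ for every $r>0$), such that $w_n^{Y,A_i}\sim\beta_i n^{1-\alpha}\ell(n)$ as $n\to\infty$ for $i=1,\dots,d$. (C3) $\Big\{\frac1{w_n^{Y,A_d}}\sum_{k=0}^{n-1}\hat T^k1_{Y_k\cap A_d}\Big\}_{n\ge2}$ is bounded in $L^\infty(\mu)$. (C4) There is $N\ge2$ such that $\Big\{\frac1{w_n^{Y,A_i}}\sum_{k=0}^{n-1}\hat T^k1_{Y_k\cap A_i}\Big\}_{n\ge N,\ 1\le i\le d-1}$ is uniformly sweeping for $1_Y$. (C5) There are $H^{(1)},\dots,H^{(d-1)}\in L^\infty(\mu)$ such that $\frac1{w_n^{Y,A_i}}\sum_{k=0}^{n-1}\hat T^k1_{Y_k\cap A_i}\to H^{(i)}$ in $L^\infty(\mu)$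 as $n\to\infty$, for $1\le i\le d-1$. Let $G\in L^1(\mu)$ with $G\ge0$, and let $\lambda_1,\dots,\lambda_{d-1}\in(0,\infty)$. Then: (1) If $G$ is uniformly sweeping for $1_Y$, then there is $C_1\in(0,\infty)$ such that, for every positive-valued sequence $\{c(n)\}_{n\ge0}$ with $c(n)\to0$ and $c(n)n\to\infty$, $$C_1\le\liminf_{n\to\infty}\frac{\ell(c(n)n)}{c(n)^\alpha\ell(n)}\,\mu_G\Big(\frac1n\sum_{i=1}^{d-1}\lambda_iS_n^{A_i}\le c(n)\Big).$$ (2) If $1_Y$ is uniformly sweeping for $G$, then there is $C_2\in(0,\infty)$ such that, for every positive-valued sequence $\{c(n)\}_{n\ge0}$ with $c(n)\to0$ and $c(n)n\to\infty$, $$\limsup_{n\to\infty}\frac{\ell(c(n)n)}{c(n)^\alpha\ell(n)}\,\mu_G\Big(\frac1n\sum_{i=1}^{d-1}\lambda_iS_n^{A_i}\le c(n)\Big)\le C_2.$$ -/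

import Mathlib

open MeasureTheory Filter Topology Asymptotics
open scoped ENNReal

namespace InfErgodic

noncomputable section

variable {X : Type*} [MeasurableSpace X]

/-- `T` is a conservative, ergodic, measure-preserving transformation of `(X, μ)`
(`Ergodic` contains that `T` is measurable and preserves `μ`). -/
structure IsCEMPT (T : X → X) (μ : Measure X) : Prop where
  ergodic : Ergodic T μ
  conservative : Conservative T μ

/-- The measure `μ_u`, with density `u ≥ 0` with respect to `μ`. -/
def densityMeasure (μ : Measure X) (u : X → ℝ) : Measure X :=
  μ.withDensity fun x => ENNReal.ofReal (u x)

/-- The transfer operator on non-negative measurable functions: `T̂ u = d(μ_u ∘ T⁻¹)/dμ`. -/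
def transferOp (μ : Measure X) (T : X → X) (u : X → ℝ≥0∞) : X → ℝ≥0∞ :=
  ((μ.withDensity u).map T).rnDeriv μ

/-- The family `𝓗` of non-negative functions is uniformly sweeping for `G`: there are `C > 0`
and `K ∈ {0, 1, 2, …}` with `C ∑_{k=0}^K T̂^k H ≥ G` a.e. for every `H ∈ 𝓗`. -/
def UniformlySweeping (μ : Measure X) (T : X → X) (𝓗 : Set (X → ℝ≥0∞)) (G : X → ℝ≥0∞) : Prop :=
  ∃ C : ℝ, 0 < C ∧ ∃ K : ℕ, ∀ H ∈ 𝓗, ∀ᵐ x ∂μ,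
    G x ≤ ENNReal.ofReal C * ∑ k ∈ Finset.range (K + 1), (transferOp μ T)^[k] H x

/-- A positive, measurable function `ℓ : (0, ∞) → (0, ∞)` that is slowly varying at `∞`.
(The values of `ℓ : ℝ → ℝ` outside `(0, ∞)` play no role.) -/
structure SlowlyVarying (ℓ : ℝ → ℝ) : Prop where
  pos : ∀ t, 0 < t → 0 < ℓ t
  measurable : Measurable fun t : Set.Ioi (0 : ℝ) => ℓ t
  tendsto : ∀ r, 0 < r → Tendsto (fun t => ℓ (r * t) / ℓ t) atTop (𝓝 1)

/-- `Y_n = T⁻ⁿY \ ⋃_{k<n} T⁻ᵏY`, the set of points that hit `Y` at time `n` and not before. -/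
def hittingSet (T : X → X) (Y : Set X) (n : ℕ) : Set X :=
  (T^[n] ⁻¹' Y) \ ⋃ k ∈ Finset.range n, T^[k] ⁻¹' Y

/-- The wandering rate `w_n^{Y,A} = μ(⋃_{k<n} (T⁻ᵏY) ∩ A)` of `Y` starting from `A`. -/
def wanderingRate (μ : Measure X) (T : X → X) (Y A : Set X) (n : ℕ) : ℝ≥0∞ :=
  μ (⋃ k ∈ Finset.range n, (T^[k] ⁻¹' Y) ∩ A)

/-- The functions `(1 / w_n^{Y,A}) ∑_{k=0}^{n-1} T̂^k 1_{Y_k ∩ A}`. -/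
def entranceDensity (μ : Measure X) (T : X → X) (Y A : Set X) (n : ℕ) (x : X) : ℝ≥0∞ :=
  (∑ k ∈ Finset.range n, (transferOp μ T)^[k] ((hittingSet T Y k ∩ A).indicator 1) x) /
    wanderingRate μ T Y A n

/-- The occupation time `S_n^A(x) = ∑_{k=1}^n 1_A(T^k x)`. -/
def occupationTime (T : X → X) (A : Set X) (n : ℕ) (x : X) : ℝ :=
  ∑ k ∈ Finset.Icc 1 n, A.indicator (fun _ => (1 : ℝ)) (T^[k] x)

/-- `Y` dynamically separates the sets `A i`: `A_i ∩ T⁻¹A_j = ∅` for `i ≠ j`. Here `Y` is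
the complement of the union of the `A i`. -/
def DynamicallySeparated {ι : Type*} (T : X → X) (A : ι → Set X) : Prop :=
  ∀ i j, i ≠ j → A i ∩ T ⁻¹' (A j) = ∅

/-- The quantity
`ℓ(c(n) n) / (c(n)^α ℓ(n)) * μ_G ( (1/n) ∑_i lam_i S_n^{A_i} ≤ c(n) )`, in `[0, ∞]`. -/
def normalizedDeviation {m : ℕ} (μ : Measure X) (T : X → X) (A : Fin m → Set X)
    (lam : Fin m → ℝ) (α : ℝ) (ℓ : ℝ → ℝ) (G : X → ℝ) (c : ℕ → ℝ) (n : ℕ) : ℝ≥0∞ :=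
  ENNReal.ofReal (ℓ (c n * n) / (c n ^ α * ℓ n)) *
    densityMeasure μ G {x | (1 / (n : ℝ)) * ∑ i, lam i * occupationTime T (A i) n x ≤ c n}

end

end InfErgodic

/-! Put `r = ∑ λ_i 1_{A_i}` with weight `0` on `A_d`, write `S_n` for the Birkhoff sums of `r`, and
let `g(t) = t^{-α} ℓ(t)`. Since `g(cn)/g(n) = ℓ(cn)/(c^α ℓ(n))`, it is enough to show that `g(y) μ(Y
∩ {S_n ≤ y})` is comparable to `g(n)`, uniformly for large `y` and all `n ≥ y`. This is
`IsSeparating.exists_measure_bounds`; sweeping then transfers the bounds from `1_Y` to `G`.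

The comparison is a double Laplace transform argument. For `f = 1/x + r/y` let `V = ∑_n exp(-S_n
f)`. The equation `V = 1 + e^{-f} V ∘ T`, invariance of `μ` and the constancy of `f` along each
excursion from `Y` give an exact identity (`IsSeparating.discountedSum_identity`). With `q = 1/x`
and `s_i = 1/x + λ_i/y`, it equates a combination of `∫_Y V` and of the Laplace transforms of
`∫_{Y_k ∩ A_i} V ∘ T^k` with a combination of `μ(Y)` and of the Laplace transforms of `μ(Y_k ∩
A_i)`.

The wandering rates control the latter transforms; the right side has order `x^{1-α} ℓ(x)`, coming
from `A_d`, where `s_d = 1/x`. The former are compared with `∫_Y V`: from below by sweeping of the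
entrance densities of one `A_i` with `λ_i > 0`, from above by boundedness of all entrance densities.
Hence `g(y) ∫_Y V` is comparable to `x^{1-α} ℓ(x)` for `x ≥ y` (`exists_lintegral_discountedSum_le`,
`exists_le_lintegral_discountedSum`).

Finally, `∫_Y V` is the Laplace transform in `n`, at `1/x`, of the nonincreasing sequence `∫_Y
exp(-S_n/y)`. Monotonicity gives bounds for this sequence itself
(`exists_bounds_of_laplaceSum_bounds`), and a Chebyshev type argument passes to `μ(Y ∩ {S_n ≤ y})`
(`exists_bounds_of_laplace_functional_bounds`). -/

namespace InfErgodic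

/-! ### Duality for the transfer operator. -/

section Transfer

variable {X : Type*} [MeasurableSpace X] {μ : Measure X} {T : X → X}

theorem measurable_transferOp (u : X → ℝ≥0∞) : Measurable (transferOp μ T u) :=
  Measure.measurable_rnDeriv _ _

theorem aemeasurable_iterate_transferOp {u : X → ℝ≥0∞} (hu : AEMeasurable u μ) (k : ℕ) :
    AEMeasurable ((transferOp μ T)^[k] u) μ := by
  cases k with
  | zero => simpa using hu
  | succ k =>
    rw [Function.iterate_succ_apply']
    exact (measurable_transferOp _).aemeasurable

variable [SigmaFinite μ]

theorem lintegral_transferOp_mul (hT : MeasurePreserving T μ μ) {u g : X → ℝ≥0∞}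
    (hu : AEMeasurable u μ) (hg : Measurable g) :
    ∫⁻ x, transferOp μ T u x * g x ∂μ = ∫⁻ x, u x * g (T x) ∂μ := by
  have hac : (μ.withDensity u).map T ≪ μ := by
    have h := (withDensity_absolutelyContinuous μ u).map hT.measurable
    rwa [hT.map_eq] at h
  have h1 : μ.withDensity (transferOp μ T u) = (μ.withDensity u).map T :=
    Measure.withDensity_rnDeriv_eq _ _ hac
  have h2 := lintegral_withDensity_eq_lintegral_mul μ
    (measurable_transferOp (μ := μ) (T := T) u) hg
  rw [h1, lintegral_map hg hT.measurable,
    lintegral_withDensity_eq_lintegral_mul₀ (g := fun x => g (T x)) hu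
      (hg.comp hT.measurable).aemeasurable] at h2
  exact h2.symm

theorem lintegral_iterate_transferOp_mul (hT : MeasurePreserving T μ μ) {u : X → ℝ≥0∞}
    (hu : AEMeasurable u μ) (k : ℕ) {g : X → ℝ≥0∞} (hg : Measurable g) :
    ∫⁻ x, (transferOp μ T)^[k] u x * g x ∂μ = ∫⁻ x, u x * g (T^[k] x) ∂μ := by
  induction k generalizing g with
  | zero => simp
  | succ k ih =>
    rw [Function.iterate_succ_apply',
      lintegral_transferOp_mul hT (aemeasurable_iterate_transferOp hu k) hg,
      ih (g := fun x => g (T x)) (hg.comp hT.measurable)]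
    simp only [Function.iterate_succ_apply']

/-- Sweeping in dual form: by duality each power of the transfer operator moves to the test function
as a time shift. -/
theorem lintegral_mul_le_of_sweeping (hT : MeasurePreserving T μ μ) {H G : X → ℝ≥0∞}
    (hH : AEMeasurable H μ) {C : ℝ≥0∞} {K : ℕ}
    (h : ∀ᵐ x ∂μ, G x ≤ C * ∑ k ∈ Finset.range (K + 1), (transferOp μ T)^[k] H x)
    {g : X → ℝ≥0∞} (hg : Measurable g) :
    ∫⁻ x, G x * g x ∂μ ≤ C * ∑ k ∈ Finset.range (K + 1), ∫⁻ x, H x * g (T^[k] x) ∂μ := by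
  have hm : ∀ k, AEMeasurable (fun x => (transferOp μ T)^[k] H x * g x) μ := fun k =>
    (aemeasurable_iterate_transferOp hH k).mul hg.aemeasurable
  calc ∫⁻ x, G x * g x ∂μ
      ≤ ∫⁻ x, C * ∑ k ∈ Finset.range (K + 1), (transferOp μ T)^[k] H x * g x ∂μ := by
        refine lintegral_mono_ae ?_
        filter_upwards [h] with x hx
        rw [← Finset.sum_mul, ← mul_assoc]
        gcongr
    _ = C * ∑ k ∈ Finset.range (K + 1), ∫⁻ x, H x * g (T^[k] x) ∂μ := by
        rw [lintegral_const_mul'' _ (Finset.aemeasurable_fun_sum _ fun k _ => hm k),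
          lintegral_finsetSum' _ fun k _ => hm k]
        congr 1
        exact Finset.sum_congr rfl fun k _ => lintegral_iterate_transferOp_mul hT hH k hg

end Transfer

/-! ### Laplace transforms of non-negative sequences. -/

section Laplace

/-- The Laplace transform `∑ₖ e^{-ks} p(k)` of a non-negative sequence. -/
noncomputable def laplaceSum (p : ℕ → ℝ≥0∞) (s : ℝ) : ℝ≥0∞ :=
  ∑' k : ℕ, ENNReal.ofReal (Real.exp (-(k * s))) * p k

theorem laplaceSum_anti (p : ℕ → ℝ≥0∞) {s t : ℝ} (hst : s ≤ t) :
    laplaceSum p t ≤ laplaceSum p s := by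
  unfold laplaceSum
  gcongr

theorem sum_range_le_laplaceSum (p : ℕ → ℝ≥0∞) {s : ℝ} (hs : 0 ≤ s) {n : ℕ} (hn : n * s ≤ 1) :
    ENNReal.ofReal (Real.exp (-1)) * ∑ k ∈ Finset.range n, p k ≤ laplaceSum p s := by
  rw [Finset.mul_sum]
  refine le_trans (Finset.sum_le_sum fun k hk => ?_) (ENNReal.sum_le_tsum (Finset.range n))
  have hk' : (k : ℝ) ≤ n := by exact_mod_cast (Finset.mem_range.1 hk).le
  have : (k : ℝ) * s ≤ n * s := by gcongr
  gcongr
  linarith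

theorem half_le_one_sub_exp_neg {s : ℝ} (hs : 0 ≤ s) (hs1 : s ≤ 1) :
    s / 2 ≤ 1 - Real.exp (-s) := by
  have h1 : Real.exp (-s) ≤ 1 / (1 + s) := by
    rw [Real.exp_neg, ← one_div]
    exact one_div_le_one_div_of_le (by linarith) (by linarith [Real.add_one_le_exp s])
  have h2 : 1 / (1 + s) ≤ 1 - s / 2 := by
    rw [div_le_iff₀ (by linarith)]
    nlinarith
  linarith

theorem tsum_exp_geometric {s : ℝ} (hs : 0 < s) (n : ℕ) :
    ∑' j : ℕ, ENNReal.ofReal (Real.exp (-((n + j : ℕ) * s)))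
      = ENNReal.ofReal (Real.exp (-(n * s)) / (1 - Real.exp (-s))) := by
  have h1 : Real.exp (-s) < 1 := by simpa using hs
  have hfun : ∀ j : ℕ, Real.exp (-((n + j : ℕ) * s))
      = Real.exp (-(n * s)) * Real.exp (-s) ^ j := by
    intro j
    rw [← Real.exp_nat_mul, ← Real.exp_add]
    push_cast
    ring_nf
  simp_rw [hfun]
  rw [← ENNReal.ofReal_tsum_of_nonneg (fun j => by positivity)
    ((summable_geometric_of_lt_one (Real.exp_pos _).le h1).mul_left _), tsum_mul_left,
    tsum_geometric_of_lt_one (Real.exp_pos _).le h1, div_eq_mul_inv]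

/-- Abel summation: write `e^{-ks}` as the tail from `k` of the geometric weights `(1 - e^{-s})
e^{-js}` and exchange the sums. -/
theorem laplaceSum_eq_tsum_sum_range (p : ℕ → ℝ≥0∞) {s : ℝ} (hs : 0 < s) :
    laplaceSum p s = ∑' j : ℕ, ENNReal.ofReal ((1 - Real.exp (-s)) * Real.exp (-(j * s))) *
      ∑ k ∈ Finset.range (j + 1), p k := by
  have h1 : 0 < 1 - Real.exp (-s) := by simpa using hs
  have h2 : ∀ k : ℕ, ENNReal.ofReal (Real.exp (-(k * s))) = ∑' j : ℕ, if k ≤ j then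
      ENNReal.ofReal ((1 - Real.exp (-s)) * Real.exp (-(j * s))) else 0 := by
    intro k
    have h3 := Summable.sum_add_tsum_nat_add' (k := k) (f := fun j : ℕ => if k ≤ j then
      ENNReal.ofReal ((1 - Real.exp (-s)) * Real.exp (-(j * s))) else 0) ENNReal.summable
    rw [← h3, Finset.sum_eq_zero, zero_add]
    · simp only [le_add_iff_nonneg_left, zero_le, if_true]
      simp_rw [ENNReal.ofReal_mul h1.le, ENNReal.tsum_mul_left, add_comm _ k]
      rw [tsum_exp_geometric hs, ← ENNReal.ofReal_mul h1.le]
      congr 1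
      field_simp
    · intro j hj
      rw [if_neg (by simpa using hj)]
  unfold laplaceSum
  simp_rw [h2, ← ENNReal.tsum_mul_right]
  rw [ENNReal.tsum_comm]
  refine tsum_congr fun j => ?_
  rw [Finset.mul_sum, tsum_eq_sum (s := Finset.range (j + 1))]
  · refine Finset.sum_congr rfl fun k hk => ?_
    rw [if_pos (by simpa [Nat.lt_succ_iff] using hk)]
  · intro k hk
    rw [if_neg (by simpa [Nat.lt_succ_iff] using hk), zero_mul]

/-- After Abel summation the weights have total mass `1`, so an additive constant passes through
unchanged. -/
theorem laplaceSum_le_of_sum_range_le {b p : ℕ → ℝ≥0∞} {M D : ℝ≥0∞}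
    (h : ∀ n, ∑ k ∈ Finset.range n, b k ≤ M * ∑ k ∈ Finset.range n, p k + D)
    {s : ℝ} (hs : 0 < s) : laplaceSum b s ≤ M * laplaceSum p s + D := by
  have h1 : 0 < 1 - Real.exp (-s) := by simpa using hs
  have hone : ∑' j : ℕ, ENNReal.ofReal ((1 - Real.exp (-s)) * Real.exp (-(j * s))) = 1 := by
    simp_rw [ENNReal.ofReal_mul h1.le, ENNReal.tsum_mul_left]
    have := tsum_exp_geometric hs 0
    simp only [zero_add, CharP.cast_eq_zero, zero_mul, neg_zero, Real.exp_zero] at this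
    rw [this, ← ENNReal.ofReal_mul h1.le, mul_one_div_cancel h1.ne', ENNReal.ofReal_one]
  rw [laplaceSum_eq_tsum_sum_range b hs, laplaceSum_eq_tsum_sum_range p hs]
  calc _ ≤ ∑' j : ℕ, (M * (ENNReal.ofReal ((1 - Real.exp (-s)) * Real.exp (-(j * s))) *
      ∑ k ∈ Finset.range (j + 1), p k)
        + ENNReal.ofReal ((1 - Real.exp (-s)) * Real.exp (-(j * s))) * D) := by
        refine ENNReal.tsum_le_tsum fun j => ?_
        refine (mul_le_mul_right (h (j + 1)) _).trans (le_of_eq ?_)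
        ring
    _ = _ := by
        rw [ENNReal.tsum_add, ENNReal.tsum_mul_left, ENNReal.tsum_mul_right, hone, one_mul]

/-- Cut at `n = ⌊1/t⌋`: by monotonicity the tail is at most `(2/s) p(n-1)`, and `p(n-1)` is at most
an average of the earlier terms. The uniformity in `s ≤ t` is what is needed later, where `s` can be
far smaller than `t`. -/
theorem mul_laplaceSum_le {p : ℕ → ℝ≥0∞} (hp : ∀ j k, 1 ≤ j → j ≤ k → p k ≤ p j)
    {s t : ℝ} (hs : 0 < s) (hst : s ≤ t) (ht : t ≤ 1 / 2) :
    ENNReal.ofReal s * laplaceSum p s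
      ≤ ENNReal.ofReal (7 * t) * ∑ k ∈ Finset.range ⌊1 / t⌋₊, p k := by
  have ht0 : 0 < t := hs.trans_le hst
  set n := ⌊1 / t⌋₊ with hn
  have hn2 : 2 ≤ n := Nat.le_floor (by rw [le_div_iff₀ ht0]; push_cast; linarith)
  have hnt : 1 < ((n : ℝ) + 1) * t := by
    have := Nat.lt_floor_add_one (1 / t)
    rwa [div_lt_iff₀ ht0] at this
  have hn2' : (2 : ℝ) ≤ n := by exact_mod_cast hn2
  set W := ∑ k ∈ Finset.range n, p k with hW
  have hpn : ENNReal.ofReal (n - 1) * p (n - 1) ≤ W := by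
    have h1 : ∑ k ∈ Finset.Ico 1 n, p (n - 1) ≤ ∑ k ∈ Finset.Ico 1 n, p k :=
      Finset.sum_le_sum fun k hk => by
        rw [Finset.mem_Ico] at hk
        exact hp _ _ hk.1 (by omega)
    have h2 : ∑ k ∈ Finset.Ico 1 n, p k ≤ W :=
      Finset.sum_le_sum_of_subset fun k hk => by
        rw [Finset.mem_Ico] at hk
        exact Finset.mem_range.2 hk.2
    refine le_trans (le_of_eq ?_) (h1.trans h2)
    have : (n : ℝ) - 1 = ((n - 1 : ℕ) : ℝ) := by push_cast [show 1 ≤ n by omega]; ring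
    rw [this, ENNReal.ofReal_natCast]
    simp
  have hexp : s / 2 ≤ 1 - Real.exp (-s) := half_le_one_sub_exp_neg hs.le (by linarith)
  have htail : ENNReal.ofReal s * ∑' j : ℕ, ENNReal.ofReal (Real.exp (-((n + j : ℕ) * s)))
      ≤ ENNReal.ofReal 2 := by
    rw [tsum_exp_geometric hs, ← ENNReal.ofReal_mul hs.le]
    refine ENNReal.ofReal_le_ofReal ?_
    rw [← mul_div_assoc, div_le_iff₀ (by linarith)]
    have : Real.exp (-(n * s)) ≤ 1 := Real.exp_le_one_iff.2 (by nlinarith)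
    nlinarith
  have hlap : laplaceSum p s ≤ W +
      (∑' j : ℕ, ENNReal.ofReal (Real.exp (-((n + j : ℕ) * s)))) * p (n - 1) := by
    unfold laplaceSum
    rw [← Summable.sum_add_tsum_nat_add' (k := n) (f := fun k : ℕ =>
      ENNReal.ofReal (Real.exp (-(k * s))) * p k) ENNReal.summable, ← ENNReal.tsum_mul_right]
    refine add_le_add (Finset.sum_le_sum fun k hk => ?_) (ENNReal.tsum_le_tsum fun j => ?_)
    · refine mul_le_of_le_one_left zero_le (ENNReal.ofReal_le_one.2 ?_)
      exact Real.exp_le_one_iff.2 (by simp only [Left.neg_nonpos_iff]; positivity)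
    · rw [add_comm n j]
      exact mul_le_mul_right (hp _ _ (by omega) (by omega)) _
  -- As `n ≥ 2` and `(n + 1) t > 1`, one has `3 (n - 1) t ≥ (n + 1) t > 1`.
  have hfin : ENNReal.ofReal 2 * p (n - 1) ≤ ENNReal.ofReal (6 * t) * W := by
    refine le_trans ?_ (mul_le_mul_right hpn _)
    rw [← mul_assoc, ← ENNReal.ofReal_mul (by positivity)]
    gcongr
    nlinarith
  calc ENNReal.ofReal s * laplaceSum p s
      ≤ ENNReal.ofReal s * W + ENNReal.ofReal s *
        (∑' j : ℕ, ENNReal.ofReal (Real.exp (-((n + j : ℕ) * s)))) * p (n - 1) := by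
        rw [mul_assoc, ← mul_add]
        gcongr
    _ ≤ ENNReal.ofReal t * W + ENNReal.ofReal 2 * p (n - 1) := by gcongr
    _ ≤ ENNReal.ofReal t * W + ENNReal.ofReal (6 * t) * W := by gcongr
    _ = ENNReal.ofReal (7 * t) * W := by
        rw [← add_mul, ← ENNReal.ofReal_add ht0.le (by positivity)]
        congr 2
        ring

end Laplace

/-! ### Slow and regular variation. -/

section SlowVariation

/-- A weak form of the uniform convergence theorem, in additive notation. -/
theorem eventually_forall_abs_sub_le {h : ℝ → ℝ} (hm : Measurable h)
    (hlim : ∀ u, Tendsto (fun x => h (x + u) - h x) atTop (𝓝 0)) {ε : ℝ} (hε : 0 < ε) :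
    ∀ᶠ x in atTop, ∀ v ∈ Set.Icc (0 : ℝ) 1, |h (x + v) - h x| ≤ ε := by
  -- The bad increments at `x`; their measure inside `[0, 2]` tends to `0` by dominated convergence.
  set B : ℝ → Set ℝ := fun x => {u | ε / 2 ≤ |h (x + u) - h x|} with hB
  have hBm : ∀ x, MeasurableSet (B x) := fun x =>
    measurableSet_le measurable_const
      (((hm.comp (measurable_const.add measurable_id)).sub measurable_const).abs)
  have hF : Tendsto (fun x => volume (Set.Icc (0 : ℝ) 2 ∩ B x)) atTop (𝓝 0) := by
    have h1 : ∀ x, volume (Set.Icc (0 : ℝ) 2 ∩ B x)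
        = ∫⁻ u in Set.Icc (0 : ℝ) 2, (B x).indicator 1 u := by
      intro x
      rw [lintegral_indicator_one (hBm x), Measure.restrict_apply (hBm x), Set.inter_comm]
    simp_rw [h1]
    have h2 : ∫⁻ u in Set.Icc (0 : ℝ) 2, (0 : ℝ≥0∞) = 0 := by simp
    rw [← h2]
    refine tendsto_lintegral_filter_of_dominated_convergence (fun _ => 1) ?_ ?_ ?_ ?_
    · exact Eventually.of_forall fun x => measurable_one.indicator (hBm x)
    · exact Eventually.of_forall fun x => Eventually.of_forall fun u =>
        Set.indicator_le_self' (fun _ _ => zero_le) u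
    · simp
    · refine Eventually.of_forall fun u => ?_
      refine tendsto_const_nhds.congr' ?_
      have h3 := (hlim u).abs
      rw [abs_zero] at h3
      filter_upwards [h3.eventually_lt_const (half_pos hε)] with x hx
      rw [Set.indicator_of_notMem]
      simpa [hB] using hx
  have hsmall : ∀ᶠ x in atTop, volume (Set.Icc (0 : ℝ) 2 ∩ B x) < ENNReal.ofReal (1 / 2) :=
    hF.eventually_lt_const (by simp)
  obtain ⟨x₀, hx₀⟩ := eventually_atTop.1 hsmall
  filter_upwards [eventually_ge_atTop x₀] with x hx v hv
  have h1 := hx₀ x hx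
  have h2 := hx₀ (x + v) (by linarith [hv.1])
  set S₁ := Set.Icc (0 : ℝ) 2 ∩ B x
  set S₂ := (fun u => u - v) ⁻¹' (Set.Icc (0 : ℝ) 2 ∩ B (x + v))
  have hS₂ : volume S₂ = volume (Set.Icc (0 : ℝ) 2 ∩ B (x + v)) := by
    simp only [S₂, sub_eq_add_neg]
    exact measure_preimage_add_right volume (-v) _
  -- The two bad sets have total measure less than `1`. A common good `u` lets `h x` and `h (x + v)`
  -- both be compared with `h (x + u)`.
  have hne : ∃ u ∈ Set.Icc (1 : ℝ) 2, u ∉ S₁ ∪ S₂ := by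
    by_contra! hcon
    have h3 : volume (Set.Icc (1 : ℝ) 2) ≤ volume S₁ + volume S₂ :=
      (measure_mono hcon).trans (measure_union_le _ _)
    rw [hS₂, Real.volume_Icc] at h3
    have h4 := h3.trans_lt (ENNReal.add_lt_add h1 h2)
    rw [← ENNReal.ofReal_add (by norm_num) (by norm_num)] at h4
    norm_num at h4
  obtain ⟨u, hu, hu'⟩ := hne
  rw [Set.mem_union, not_or] at hu'
  have h5 : |h (x + u) - h x| < ε / 2 := by
    by_contra! hc
    exact hu'.1 ⟨⟨by linarith [hu.1], hu.2⟩, hc⟩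
  have h6 : |h (x + u) - h (x + v)| < ε / 2 := by
    by_contra! hc
    refine hu'.2 ⟨⟨by linarith [hu.1, hv.2], by linarith [hu.2, hv.1]⟩, ?_⟩
    have : x + v + (u - v) = x + u := by ring
    simpa [hB, this] using hc
  rw [abs_lt] at h5 h6
  rw [abs_le]
  constructor <;> linarith

theorem SlowlyVarying.eventually_le_two_mul {ℓ : ℝ → ℝ} (hℓ : SlowlyVarying ℓ) :
    ∀ᶠ x in atTop, ∀ v ∈ Set.Icc (1 : ℝ) 2, ℓ (v * x) ≤ 2 * ℓ x ∧ ℓ x ≤ 2 * ℓ (v * x) := by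
  have hm : Measurable fun u => Real.log (ℓ (Real.exp u)) :=
    Real.measurable_log.comp (hℓ.measurable.comp
      (Real.measurable_exp.subtype_mk (h := fun u => Real.exp_pos u)))
  have hlim : ∀ u, Tendsto (fun x => Real.log (ℓ (Real.exp (x + u))) - Real.log (ℓ (Real.exp x)))
      atTop (𝓝 0) := by
    intro u
    have h1 := ((hℓ.tendsto _ (Real.exp_pos u)).comp Real.tendsto_exp_atTop).log one_ne_zero
    rw [Real.log_one] at h1
    refine h1.congr fun x => ?_
    rw [Function.comp, Real.log_div (hℓ.pos _ (by positivity)).ne'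
      (hℓ.pos _ (by positivity)).ne', Real.exp_add, mul_comm (Real.exp u)]
  have hev := eventually_forall_abs_sub_le hm hlim (Real.log_pos one_lt_two)
  filter_upwards [Real.tendsto_log_atTop.eventually hev, eventually_gt_atTop 0] with x hx hx0 v hv
  have hv0 : 0 < v := by linarith [hv.1]
  have h1 := hx (Real.log v) ⟨Real.log_nonneg hv.1, by
    have := Real.log_le_sub_one_of_pos hv0
    linarith [hv.2]⟩
  rw [← Real.log_mul hx0.ne' hv0.ne', Real.exp_log (by positivity), Real.exp_log hx0,
    mul_comm x v, abs_le] at h1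
  have p1 := hℓ.pos (v * x) (by positivity)
  have p2 := hℓ.pos x hx0
  constructor
  · rw [← Real.log_le_log_iff p1 (by positivity), Real.log_mul two_ne_zero p2.ne']
    linarith [h1.2]
  · rw [← Real.log_le_log_iff p2 (by positivity), Real.log_mul two_ne_zero p1.ne']
    linarith [h1.1]

/-- The regularly varying function `x ^ ρ * ℓ x`. -/
noncomputable def regVar (ℓ : ℝ → ℝ) (ρ x : ℝ) : ℝ := x ^ ρ * ℓ x

theorem SlowlyVarying.regVar_pos {ℓ : ℝ → ℝ} (hℓ : SlowlyVarying ℓ) (ρ : ℝ) {x : ℝ} (hx : 0 < x) :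
    0 < regVar ℓ ρ x :=
  mul_pos (Real.rpow_pos_of_pos hx _) (hℓ.pos x hx)

theorem SlowlyVarying.tendsto_regVar {ℓ : ℝ → ℝ} (hℓ : SlowlyVarying ℓ) (ρ : ℝ) {r : ℝ}
    (hr : 0 < r) :
    Tendsto (fun x => regVar ℓ ρ (r * x) / regVar ℓ ρ x) atTop (𝓝 (r ^ ρ)) := by
  have h := (hℓ.tendsto r hr).const_mul (r ^ ρ)
  rw [mul_one] at h
  refine h.congr' ?_
  filter_upwards [eventually_gt_atTop 0] with x hx
  have := (Real.rpow_pos_of_pos hx ρ).ne'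
  have := (hℓ.pos x hx).ne'
  unfold regVar
  rw [Real.mul_rpow hr.le hx.le]
  field_simp

theorem SlowlyVarying.eventually_regVar_le {ℓ : ℝ → ℝ} (hℓ : SlowlyVarying ℓ) (ρ : ℝ) {r : ℝ}
    (hr : 0 < r) {C : ℝ} (hC : r ^ ρ < C) :
    ∀ᶠ x in atTop, regVar ℓ ρ (r * x) ≤ C * regVar ℓ ρ x := by
  filter_upwards [(hℓ.tendsto_regVar ρ hr).eventually_lt_const hC, eventually_gt_atTop 0]
    with x hx hx0
  rw [div_lt_iff₀ (hℓ.regVar_pos ρ hx0)] at hx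
  exact hx.le

theorem SlowlyVarying.eventually_le_regVar {ℓ : ℝ → ℝ} (hℓ : SlowlyVarying ℓ) (ρ : ℝ) {r : ℝ}
    (hr : 0 < r) {C : ℝ} (hC : C < r ^ ρ) :
    ∀ᶠ x in atTop, C * regVar ℓ ρ x ≤ regVar ℓ ρ (r * x) := by
  filter_upwards [(hℓ.tendsto_regVar ρ hr).eventually_const_lt hC, eventually_gt_atTop 0]
    with x hx hx0
  rw [lt_div_iff₀ (hℓ.regVar_pos ρ hx0)] at hx
  exact hx.le

theorem SlowlyVarying.eventually_regVar_floor {ℓ : ℝ → ℝ} (hℓ : SlowlyVarying ℓ) {ρ : ℝ}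
    (hρ0 : 0 ≤ ρ) (hρ1 : ρ ≤ 1) :
    ∀ᶠ x in atTop, regVar ℓ ρ x ≤ 4 * regVar ℓ ρ (⌊x⌋₊ : ℝ) ∧
      regVar ℓ ρ (⌊x⌋₊ : ℝ) ≤ 4 * regVar ℓ ρ x := by
  have h1 : Tendsto (fun x : ℝ => (⌊x⌋₊ : ℝ)) atTop atTop :=
    tendsto_natCast_atTop_atTop.comp tendsto_nat_floor_atTop
  filter_upwards [h1.eventually hℓ.eventually_le_two_mul, eventually_ge_atTop 1] with x hx hx1
  have hn1 : (1 : ℝ) ≤ ⌊x⌋₊ := by exact_mod_cast Nat.le_floor (by simpa using hx1)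
  have hle : (⌊x⌋₊ : ℝ) ≤ x := Nat.floor_le (by linarith)
  have hlt : x < ⌊x⌋₊ + 1 := Nat.lt_floor_add_one x
  set n : ℝ := (⌊x⌋₊ : ℝ)
  have hn0 : 0 < n := by linarith
  obtain ⟨ha, hb⟩ := hx (x / n) ⟨by rw [le_div_iff₀ hn0]; linarith, by
    rw [div_le_iff₀ hn0]; linarith⟩
  rw [div_mul_cancel₀ _ hn0.ne'] at ha hb
  have hp1 : n ^ ρ ≤ x ^ ρ := Real.rpow_le_rpow hn0.le hle hρ0
  have hp2 : x ^ ρ ≤ 2 * n ^ ρ := by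
    calc x ^ ρ ≤ (2 * n) ^ ρ := Real.rpow_le_rpow (by linarith) (by linarith) hρ0
      _ = 2 ^ ρ * n ^ ρ := Real.mul_rpow (by norm_num) hn0.le
      _ ≤ 2 ^ (1 : ℝ) * n ^ ρ := by
          gcongr
          norm_num
      _ = 2 * n ^ ρ := by rw [Real.rpow_one]
  have q1 := Real.rpow_pos_of_pos hn0 ρ
  have q2 := hℓ.pos n hn0
  have q3 := hℓ.pos x (by linarith)
  unfold regVar
  constructor
  · calc x ^ ρ * ℓ x ≤ (2 * n ^ ρ) * (2 * ℓ n) := by gcongr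
      _ = _ := by ring
  · calc n ^ ρ * ℓ n ≤ x ^ ρ * (2 * ℓ x) := by gcongr
      _ ≤ x ^ ρ * (4 * ℓ x) := by gcongr; norm_num
      _ = _ := by ring

/-- Asymptotics along the integers of a sequence give two-sided bounds at real arguments. -/
theorem SlowlyVarying.exists_floor_bounds {ℓ : ℝ → ℝ} (hℓ : SlowlyVarying ℓ) {ρ : ℝ}
    (hρ0 : 0 ≤ ρ) (hρ1 : ρ ≤ 1) {w : ℕ → ℝ≥0∞} (hw_fin : ∀ n, w n ≠ ∞) {β : ℝ} (hβ : 0 < β)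
    (hw : (fun n => (w n).toReal) ~[atTop] fun n : ℕ => β * (n : ℝ) ^ ρ * ℓ n) :
    ∃ κ > 0, ∀ᶠ x in atTop, w ⌊x⌋₊ ≤ ENNReal.ofReal (κ * regVar ℓ ρ x) ∧
      ENNReal.ofReal (regVar ℓ ρ x) ≤ ENNReal.ofReal κ * w ⌊x⌋₊ := by
  -- A factor `2` comes from the asymptotic equivalence and a factor `4` from replacing `x` by its
  -- integer part.
  refine ⟨max (8 * β) (8 / β), by positivity, ?_⟩
  have hev : ∀ᶠ n : ℕ in atTop, |(w n).toReal - β * (n : ℝ) ^ ρ * ℓ n|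
      ≤ 1 / 2 * |β * (n : ℝ) ^ ρ * ℓ n| := by
    have := hw.isLittleO.def (show (0 : ℝ) < 1 / 2 by norm_num)
    simpa using this
  filter_upwards [tendsto_nat_floor_atTop.eventually hev, hℓ.eventually_regVar_floor hρ0 hρ1,
    eventually_ge_atTop 1] with x hx hx2 hx1
  have hn1 : (1 : ℝ) ≤ ⌊x⌋₊ := by exact_mod_cast Nat.le_floor (by simpa using hx1)
  have hpos := hℓ.regVar_pos ρ (show (0 : ℝ) < ⌊x⌋₊ by linarith)
  have heq : β * (⌊x⌋₊ : ℝ) ^ ρ * ℓ ⌊x⌋₊ = β * regVar ℓ ρ (⌊x⌋₊ : ℝ) := by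
    unfold regVar; ring
  rw [heq, abs_of_pos (by positivity : 0 < β * regVar ℓ ρ (⌊x⌋₊ : ℝ)), abs_le] at hx
  have hposx := hℓ.regVar_pos ρ (show (0 : ℝ) < x by linarith)
  rw [← ENNReal.ofReal_toReal (hw_fin ⌊x⌋₊)]
  set W := (w ⌊x⌋₊).toReal
  have hW0 : 0 ≤ W := ENNReal.toReal_nonneg
  set r := regVar ℓ ρ (⌊x⌋₊ : ℝ)
  constructor
  · refine ENNReal.ofReal_le_ofReal ?_
    calc W ≤ 2 * β * r := by nlinarith
      _ ≤ 2 * β * (4 * regVar ℓ ρ x) := by gcongr; exact hx2.2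
      _ = 8 * β * regVar ℓ ρ x := by ring
      _ ≤ _ := by gcongr; exact le_max_left _ _
  · rw [← ENNReal.ofReal_mul (by positivity)]
    refine ENNReal.ofReal_le_ofReal ?_
    calc regVar ℓ ρ x ≤ 4 * r := hx2.1
      _ = 8 / β * (β * r / 2) := by field_simp; norm_num
      _ ≤ 8 / β * W := by gcongr; linarith
      _ ≤ _ := by gcongr; exact le_max_right _ _

end SlowVariation

/-! ### Hitting times and excursions away from `Y`. -/

section Excursions

variable {X : Type*} {T : X → X} {Y : Set X}

/-- The set of points that hit `Y` before time `n`. -/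
def hitBefore (T : X → X) (Y : Set X) (n : ℕ) : Set X :=
  ⋃ k ∈ Finset.range n, T^[k] ⁻¹' Y

theorem mem_hitBefore {n : ℕ} {x : X} : x ∈ hitBefore T Y n ↔ ∃ k < n, T^[k] x ∈ Y := by
  simp [hitBefore]

theorem mem_hittingSet {n : ℕ} {x : X} :
    x ∈ hittingSet T Y n ↔ T^[n] x ∈ Y ∧ ∀ k < n, T^[k] x ∉ Y := by
  simp [hittingSet]

theorem hitBefore_succ_inter (n : ℕ) (A : Set X) :
    hitBefore T Y (n + 1) ∩ A = (hitBefore T Y n ∩ A) ∪ (hittingSet T Y n ∩ A) := by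
  ext x
  simp only [Set.mem_inter_iff, Set.mem_union, mem_hitBefore, mem_hittingSet, Nat.lt_succ_iff]
  constructor
  · rintro ⟨⟨k, hk, hx⟩, hA⟩
    by_cases h : ∃ k < n, T^[k] x ∈ Y
    · exact Or.inl ⟨h, hA⟩
    · push Not at h
      obtain rfl : k = n := le_antisymm hk (not_lt.1 fun hlt => h k hlt hx)
      exact Or.inr ⟨⟨hx, h⟩, hA⟩
  · rintro (⟨⟨k, hk, hx⟩, hA⟩ | ⟨⟨hx, -⟩, hA⟩)
    · exact ⟨⟨k, hk.le, hx⟩, hA⟩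
    · exact ⟨⟨n, le_rfl, hx⟩, hA⟩

theorem disjoint_hitBefore_hittingSet (n : ℕ) (A : Set X) :
    Disjoint (hitBefore T Y n ∩ A) (hittingSet T Y n ∩ A) := by
  rw [Set.disjoint_left]
  rintro x ⟨h1, -⟩ ⟨h2, -⟩
  obtain ⟨k, hk, hx⟩ := mem_hitBefore.1 h1
  exact (mem_hittingSet.1 h2).2 k hk hx

theorem hitBefore_diff_subset (n : ℕ) :
    hitBefore T Y n \ T ⁻¹' hitBefore T Y n ⊆ Y \ T ⁻¹' hitBefore T Y n := by
  rintro x ⟨h1, h2⟩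
  refine ⟨?_, h2⟩
  obtain ⟨k, hk, hx⟩ := mem_hitBefore.1 h1
  cases k with
  | zero => exact hx
  | succ k => exact absurd (mem_hitBefore.2 ⟨k, by omega, hx⟩) h2

variable [MeasurableSpace X] {μ : Measure X}

theorem measurableSet_hitBefore (hT : Measurable T) (hY : MeasurableSet Y) (n : ℕ) :
    MeasurableSet (hitBefore T Y n) :=
  Finset.measurableSet_biUnion _ fun k _ => (hT.iterate k) hY

theorem measurableSet_hittingSet (hT : Measurable T) (hY : MeasurableSet Y) (n : ℕ) :
    MeasurableSet (hittingSet T Y n) :=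
  ((hT.iterate n) hY).diff (measurableSet_hitBefore hT hY n)

theorem setLIntegral_hitBefore_inter (hT : Measurable T) (hY : MeasurableSet Y) {A : Set X}
    (hA : MeasurableSet A) (F : X → ℝ≥0∞) (n : ℕ) :
    ∫⁻ x in hitBefore T Y n ∩ A, F x ∂μ
      = ∑ k ∈ Finset.range n, ∫⁻ x in hittingSet T Y k ∩ A, F x ∂μ := by
  induction n with
  | zero => simp [hitBefore]
  | succ n ih =>
    rw [hitBefore_succ_inter, lintegral_union ((measurableSet_hittingSet hT hY n).inter hA)
      (disjoint_hitBefore_hittingSet n A), ih, Finset.sum_range_succ]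

theorem wanderingRate_eq_sum (hT : Measurable T) (hY : MeasurableSet Y) {A : Set X}
    (hA : MeasurableSet A) (n : ℕ) :
    wanderingRate μ T Y A n = ∑ k ∈ Finset.range n, μ (hittingSet T Y k ∩ A) := by
  have h := setLIntegral_hitBefore_inter (μ := μ) hT hY hA 1 n
  simp only [Pi.one_apply, setLIntegral_one] at h
  rw [← h, wanderingRate, hitBefore, Set.iUnion₂_inter]

end Excursions

/-- `Y` is a set of finite measure separating the sets `A i` dynamically, and `Y` and the `A i`
form a measurable partition of the space. -/
structure IsSeparating {X ι : Type*} [MeasurableSpace X] (μ : Measure X) (T : X → X) (Y : Set X)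
    (A : ι → Set X) : Prop where
  isCEMPT : IsCEMPT T μ
  meas : MeasurableSet Y
  meas' : ∀ i, MeasurableSet (A i)
  cover : Y ∪ ⋃ i, A i = Set.univ
  disj : ∀ i, Disjoint Y (A i)
  pairwise : Pairwise fun i j => Disjoint (A i) (A j)
  finite : μ Y ≠ ∞
  separated : DynamicallySeparated T A

namespace IsSeparating

variable {X ι : Type*} [MeasurableSpace X] {μ : Measure X} {T : X → X} {Y : Set X}
  {A : ι → Set X} (h : IsSeparating μ T Y A)

include h

theorem mp : MeasurePreserving T μ μ := h.isCEMPT.ergodic.toMeasurePreserving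

theorem measT : Measurable T := h.mp.measurable

theorem measB (i : ι) (k : ℕ) : MeasurableSet (hittingSet T Y k ∩ A i) :=
  (measurableSet_hittingSet h.measT h.meas k).inter (h.meas' i)

/-- Separation at work: an orbit cannot pass from one `A i` to another without visiting `Y`, so each
excursion stays in one component. -/
theorem iterate_mem {i : ι} {k : ℕ} {x : X} (hx : x ∈ hittingSet T Y k ∩ A i) {j : ℕ}
    (hj : j < k) : T^[j] x ∈ A i := by
  induction j with
  | zero => exact hx.2
  | succ j ih =>
    have h1 := ih (by omega)
    have h2 : T^[j + 1] x ∉ Y := (mem_hittingSet.1 hx.1).2 _ hj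
    have h3 : T^[j + 1] x ∈ Y ∪ ⋃ i, A i := h.cover ▸ Set.mem_univ _
    obtain ⟨i', hi'⟩ := Set.mem_iUnion.1 (h3.resolve_left h2)
    by_cases hii : i = i'
    · rwa [hii]
    · have h4 : T^[j] x ∈ A i ∩ T ⁻¹' A i' := ⟨h1, by
        rw [Set.mem_preimage, ← Function.iterate_succ_apply' T]; exact hi'⟩
      rw [h.separated i i' hii] at h4
      exact h4.elim

theorem measure_hittingSet_inter_le (i : ι) (k : ℕ) : μ (hittingSet T Y k ∩ A i) ≤ μ Y := by
  refine (measure_mono (t := T^[k] ⁻¹' Y) fun x hx => (mem_hittingSet.1 hx.1).1).trans ?_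
  exact ((h.mp.iterate k).measure_preimage h.meas.nullMeasurableSet).le

/-- For `k ≥ 1`, `T` maps `Y_{k+1} ∩ A_i` into `Y_k ∩ A_i`, and `T` preserves `μ`. The index `0` is
excluded because `Y_0 = Y` is disjoint from `A_i`. -/
theorem measure_hittingSet_inter_anti (i : ι) {j k : ℕ} (hj : 1 ≤ j) (hjk : j ≤ k) :
    μ (hittingSet T Y k ∩ A i) ≤ μ (hittingSet T Y j ∩ A i) := by
  induction k, hjk using Nat.le_induction with
  | base => rfl
  | succ k hjk ih =>
    refine le_trans ?_ ih
    rw [← h.mp.measure_preimage (h.measB i k).nullMeasurableSet]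
    refine measure_mono fun x hx => ⟨mem_hittingSet.2 ⟨?_, fun l hl => ?_⟩, ?_⟩
    · exact (mem_hittingSet.1 hx.1).1
    · exact (mem_hittingSet.1 hx.1).2 (l + 1) (by omega)
    · exact h.iterate_mem hx (j := 1) (by omega)

theorem wanderingRate_eq (i : ι) (n : ℕ) :
    wanderingRate μ T Y (A i) n = ∑ k ∈ Finset.range n, μ (hittingSet T Y k ∩ A i) :=
  wanderingRate_eq_sum h.measT h.meas (h.meas' i) n

theorem wanderingRate_ne_top (i : ι) (n : ℕ) : wanderingRate μ T Y (A i) n ≠ ∞ := by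
  rw [h.wanderingRate_eq]
  exact ENNReal.sum_ne_top.2 fun k _ =>
    ((h.measure_hittingSet_inter_le i k).trans_lt h.finite.lt_top).ne

theorem measure_hitBefore_ne_top (n : ℕ) : μ (hitBefore T Y n) ≠ ∞ := by
  refine ((measure_biUnion_finset_le _ _).trans_lt (ENNReal.sum_lt_top.2 fun k _ => ?_)).ne
  rw [(h.mp.iterate k).measure_preimage h.meas.nullMeasurableSet]
  exact h.finite.lt_top

theorem setLIntegral_hitBefore [Fintype ι] (F : X → ℝ≥0∞) {n : ℕ} (hn : 1 ≤ n) :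
    ∫⁻ x in hitBefore T Y n, F x ∂μ = ∫⁻ x in Y, F x ∂μ
      + ∑ i, ∑ k ∈ Finset.range n, ∫⁻ x in hittingSet T Y k ∩ A i, F x ∂μ := by
  have h1 : hitBefore T Y n = Y ∪ ⋃ i, hitBefore T Y n ∩ A i := by
    have h2 : Y ⊆ hitBefore T Y n := fun x hx => mem_hitBefore.2 ⟨0, hn, hx⟩
    rw [← Set.inter_iUnion]
    conv_lhs => rw [← Set.inter_univ (hitBefore T Y n), ← h.cover, Set.inter_union_distrib_left,
      Set.inter_eq_right.2 h2]
  have hm : ∀ i, MeasurableSet (hitBefore T Y n ∩ A i) := fun i =>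
    (measurableSet_hitBefore h.measT h.meas n).inter (h.meas' i)
  have hd : Disjoint Y (⋃ i, hitBefore T Y n ∩ A i) :=
    Set.disjoint_iUnion_right.2 fun i => (h.disj i).mono_right Set.inter_subset_right
  conv_lhs => rw [h1]
  rw [lintegral_union (MeasurableSet.iUnion hm) hd, lintegral_iUnion hm, tsum_fintype]
  · congr 1
    exact Finset.sum_congr rfl fun i _ =>
      setLIntegral_hitBefore_inter h.measT h.meas (h.meas' i) F n
  · intro i j hij
    exact (h.pairwise hij).mono Set.inter_subset_right Set.inter_subset_right

/-- These sets consist of points of `Y` that do not return during times `1, …, n`; by conservativity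
almost every point of `Y` returns. They carry the error of the truncated integral identity. -/
theorem tendsto_measure_hitBefore_diff :
    Tendsto (fun n => μ (hitBefore T Y n \ T ⁻¹' hitBefore T Y n)) atTop (𝓝 0) := by
  have h0 : μ (⋂ n, Y \ T ⁻¹' hitBefore T Y n) = 0 := by
    refine measure_mono_null ?_
      (h.isCEMPT.conservative.measure_mem_forall_ge_image_notMem_eq_zero
        h.meas.nullMeasurableSet 1)
    intro x hx
    rw [Set.mem_iInter] at hx
    refine ⟨(hx 0).1, fun m hm hmY => ?_⟩
    obtain ⟨k, rfl⟩ : ∃ k, m = k + 1 := ⟨m - 1, by omega⟩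
    exact (hx (k + 1)).2 (mem_hitBefore.2 ⟨k, by omega, hmY⟩)
  have h1 := tendsto_measure_iInter_atTop (μ := μ) (s := fun n => Y \ T ⁻¹' hitBefore T Y n)
    (fun n => (h.meas.diff (h.measT (measurableSet_hitBefore h.measT h.meas n))).nullMeasurableSet)
    (fun m n hmn => Set.sdiff_subset_sdiff_right (Set.preimage_mono fun x hx => by
      obtain ⟨k, hk, hx⟩ := mem_hitBefore.1 hx
      exact mem_hitBefore.2 ⟨k, hk.trans_le hmn, hx⟩))
    ⟨0, ((measure_mono Set.sdiff_subset).trans_lt h.finite.lt_top).ne⟩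
  rw [h0] at h1
  exact tendsto_of_tendsto_of_tendsto_of_le_of_le tendsto_const_nhds h1 (fun _ => zero_le)
    fun n => measure_mono (hitBefore_diff_subset n)

theorem measure_preimage_hitBefore_diff (n : ℕ) :
    μ (T ⁻¹' hitBefore T Y n \ hitBefore T Y n)
      = μ (hitBefore T Y n \ T ⁻¹' hitBefore T Y n) := by
  have hm := measurableSet_hitBefore h.measT h.meas n
  have h1 := measure_inter_add_sdiff (μ := μ) (T ⁻¹' hitBefore T Y n) hm
  have h2 := measure_inter_add_sdiff (μ := μ) (hitBefore T Y n) (h.measT hm)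
  rw [h.mp.measure_preimage hm.nullMeasurableSet, ← h2, Set.inter_comm] at h1
  refine (ENNReal.add_right_inj ?_).1 h1
  exact ((measure_mono Set.inter_subset_left).trans_lt (h.measure_hitBefore_ne_top n).lt_top).ne

theorem setLIntegral_comp_le {V : X → ℝ≥0∞} (hV : Measurable V) {C : ℝ≥0∞} (hC : ∀ x, V x ≤ C)
    (n : ℕ) :
    ∫⁻ x in hitBefore T Y n, V (T x) ∂μ ≤ ∫⁻ x in hitBefore T Y n, V x ∂μ
      + C * μ (hitBefore T Y n \ T ⁻¹' hitBefore T Y n) := by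
  have hm := measurableSet_hitBefore h.measT h.meas n
  rw [← h.mp.setLIntegral_comp_preimage hm hV]
  calc _ ≤ ∫⁻ x in T ⁻¹' hitBefore T Y n ∪ (hitBefore T Y n \ T ⁻¹' hitBefore T Y n),
      V (T x) ∂μ := lintegral_mono_set (by rw [Set.union_sdiff_self]; exact Set.subset_union_right)
    _ ≤ _ := lintegral_union_le _ _ _
    _ ≤ _ := by
      gcongr
      refine (lintegral_mono fun x => hC (T x)).trans ?_
      rw [lintegral_const, Measure.restrict_apply_univ]

theorem le_setLIntegral_comp {V : X → ℝ≥0∞} (hV : Measurable V) {C : ℝ≥0∞} (hC : ∀ x, V x ≤ C)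
    (n : ℕ) :
    ∫⁻ x in hitBefore T Y n, V x ∂μ ≤ ∫⁻ x in hitBefore T Y n, V (T x) ∂μ
      + C * μ (hitBefore T Y n \ T ⁻¹' hitBefore T Y n) := by
  have hm := measurableSet_hitBefore h.measT h.meas n
  rw [← h.mp.setLIntegral_comp_preimage hm hV, ← h.measure_preimage_hitBefore_diff]
  calc _ ≤ ∫⁻ x in hitBefore T Y n ∪ (T ⁻¹' hitBefore T Y n \ hitBefore T Y n),
      V (T x) ∂μ := lintegral_mono_set (by rw [Set.union_sdiff_self]; exact Set.subset_union_right)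
    _ ≤ _ := lintegral_union_le _ _ _
    _ ≤ _ := by
      gcongr
      refine (lintegral_mono fun x => hC (T x)).trans ?_
      rw [lintegral_const, Measure.restrict_apply_univ]

end IsSeparating

/-! ### The discounted sum and its functional equation. -/

section DiscountedSum

variable {X : Type*} {T : X → X} {f : X → ℝ}

/-- The sum `∑ₙ exp(-Sₙf)` of the exponentials of the Birkhoff sums of `f`. -/
noncomputable def discountedSum (T : X → X) (f : X → ℝ) (x : X) : ℝ≥0∞ :=
  ∑' n, ENNReal.ofReal (Real.exp (-birkhoffSum T f n x))

theorem discountedSum_eq (x : X) :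
    discountedSum T f x = 1 + ENNReal.ofReal (Real.exp (-f x)) * discountedSum T f (T x) := by
  unfold discountedSum
  rw [tsum_eq_zero_add' ENNReal.summable, ← ENNReal.tsum_mul_left]
  simp only [birkhoffSum_zero, neg_zero, Real.exp_zero, ENNReal.ofReal_one]
  congr 2
  ext n
  rw [← ENNReal.ofReal_mul (Real.exp_pos _).le, ← Real.exp_add, birkhoffSum_succ', neg_add]

/-- Each time step costs at most a factor `e^F`. With `F = 1` this absorbs the bounded delays in the
sweeping conditions. -/
theorem discountedSum_iterate_le {F : ℝ} (hF : ∀ x, f x ≤ F) (k : ℕ) (x : X) :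
    discountedSum T f (T^[k] x) ≤ ENNReal.ofReal (Real.exp (k * F)) * discountedSum T f x := by
  induction k with
  | zero => simp
  | succ k ih =>
    have h1 : discountedSum T f (T^[k + 1] x)
        ≤ ENNReal.ofReal (Real.exp F) * discountedSum T f (T^[k] x) := by
      rw [discountedSum_eq (T^[k] x), ← Function.iterate_succ_apply' T, mul_add, ← mul_assoc,
        ← ENNReal.ofReal_mul (Real.exp_pos _).le, ← Real.exp_add]
      refine le_trans ?_ le_add_self
      refine le_mul_of_one_le_left zero_le (ENNReal.one_le_ofReal.2 (Real.one_le_exp ?_))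
      linarith [hF (T^[k] x)]
    refine (h1.trans (mul_le_mul_right ih _)).trans (le_of_eq ?_)
    rw [← mul_assoc, ← ENNReal.ofReal_mul (Real.exp_pos _).le, ← Real.exp_add]
    congr 3
    push_cast
    ring

theorem discountedSum_le {q : ℝ} (hq : 0 < q) (hf : ∀ x, q ≤ f x) (x : X) :
    discountedSum T f x ≤ ENNReal.ofReal (1 / (1 - Real.exp (-q))) := by
  have h1 := tsum_exp_geometric hq 0
  simp only [zero_add, CharP.cast_eq_zero, zero_mul, neg_zero, Real.exp_zero] at h1
  rw [← h1]
  refine ENNReal.tsum_le_tsum fun n => ENNReal.ofReal_le_ofReal (Real.exp_le_exp.2 ?_)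
  rw [neg_le_neg_iff, ← nsmul_eq_mul]
  unfold birkhoffSum
  simpa using Finset.card_nsmul_le_sum (Finset.range n) (fun k => f (T^[k] x)) q fun k _ => hf _

theorem measurable_discountedSum [MeasurableSpace X] (hT : Measurable T) (hf : Measurable f) :
    Measurable (discountedSum T f) := by
  refine Measurable.tsum fun n => ENNReal.measurable_ofReal.comp (Real.measurable_exp.comp
    (Measurable.neg ?_))
  unfold birkhoffSum
  exact Finset.measurable_fun_sum _ fun k _ => hf.comp (hT.iterate k)

/-- The functional equation along a stretch of the orbit on which `f` is constant. -/
theorem discountedSum_of_const {s : ℝ} (hs : 0 ≤ s) {x : X} {k : ℕ}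
    (hx : ∀ j < k, f (T^[j] x) = s) :
    ENNReal.ofReal (Real.exp s - 1) * discountedSum T f x
        + ENNReal.ofReal (Real.exp s) * ENNReal.ofReal (Real.exp (-(k * s)))
      = ENNReal.ofReal (Real.exp s) + ENNReal.ofReal (Real.exp s - 1)
        * (ENNReal.ofReal (Real.exp (-(k * s))) * discountedSum T f (T^[k] x)) := by
  -- This is `V = ∑_{j<k} e^{-js} + e^{-ks} V ∘ T^k` multiplied by `e^s - 1`, arranged without
  -- subtracting extended values.
  induction k with
  | zero => simp [add_comm]
  | succ k ih =>
    have hk := ih fun j hj => hx j (by omega)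
    set a := ENNReal.ofReal (Real.exp s - 1)
    set E := ENNReal.ofReal (Real.exp s) with hE
    have hEa : E = a + 1 := by
      rw [← ENNReal.ofReal_one, ← ENNReal.ofReal_add (by linarith [Real.add_one_le_exp s])
        zero_le_one, sub_add_cancel]
    have hb1 : E * ENNReal.ofReal (Real.exp (-((k + 1 : ℕ) * s)))
        = ENNReal.ofReal (Real.exp (-(k * s))) := by
      rw [hE, ← ENNReal.ofReal_mul (Real.exp_pos _).le, ← Real.exp_add]
      congr 2
      push_cast
      ring
    have hb2 : ENNReal.ofReal (Real.exp (-((k + 1 : ℕ) * s)))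
        = ENNReal.ofReal (Real.exp (-(k * s))) * ENNReal.ofReal (Real.exp (-s)) := by
      rw [← ENNReal.ofReal_mul (Real.exp_pos _).le, ← Real.exp_add]
      congr 2
      push_cast
      ring
    have hV := discountedSum_eq (T := T) (f := f) (T^[k] x)
    rw [hx k (by omega), ← Function.iterate_succ_apply' T] at hV
    rw [hV] at hk
    set b := ENNReal.ofReal (Real.exp (-(k * s)))
    have hfin : E * b ≠ ∞ := ENNReal.mul_ne_top ENNReal.ofReal_ne_top ENNReal.ofReal_ne_top
    refine (ENNReal.add_left_inj hfin).1 ?_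
    rw [hb1, add_right_comm, hk, hb2, hEa]
    ring

end DiscountedSum

/-! ### The integral identity for the discounted sum. -/

namespace IsSeparating

variable {X ι : Type*} [Fintype ι] [MeasurableSpace X] {μ : Measure X} {T : X → X} {Y : Set X}
  {A : ι → Set X} (h : IsSeparating μ T Y A)

include h

/-- The integral identity linking the excursions away from `Y` to the discounted sum on `Y`. -/
theorem discountedSum_identity {f : X → ℝ} (hf : Measurable f) {q : ℝ} {s : ι → ℝ} (hq : 0 < q)
    (hqs : ∀ i, q ≤ s i) (hfY : ∀ x ∈ Y, f x = q) (hfA : ∀ i, ∀ x ∈ A i, f x = s i) :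
    ENNReal.ofReal (Real.exp q - 1) * ∫⁻ x in Y, discountedSum T f x ∂μ
      + ∑ i, ENNReal.ofReal (Real.exp (s i) - 1) * laplaceSum
        (fun k => ∫⁻ x in hittingSet T Y k ∩ A i, discountedSum T f (T^[k] x) ∂μ) (s i)
    = ENNReal.ofReal (Real.exp q) * μ Y
      + ∑ i, ENNReal.ofReal (Real.exp (s i)) *
        laplaceSum (fun k => μ (hittingSet T Y k ∩ A i)) (s i) := by
  set V := discountedSum T f with hVdef
  set C := ENNReal.ofReal (1 / (1 - Real.exp (-q))) with hC
  have hfq : ∀ x, q ≤ f x := fun x => by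
    rcases (h.cover ▸ Set.mem_univ x : x ∈ Y ∪ ⋃ i, A i) with hx | hx
    · exact (hfY x hx).ge
    · obtain ⟨i, hi⟩ := Set.mem_iUnion.1 hx
      rw [hfA i x hi]
      exact hqs i
  have hVC : ∀ x, V x ≤ C := discountedSum_le hq hfq
  have hVm : Measurable V := measurable_discountedSum h.measT hf
  have hVk : ∀ k, Measurable fun x => V (T^[k] x) := fun k => hVm.comp (h.measT.iterate k)
  have hEm : Measurable fun x => ENNReal.ofReal (Real.exp (f x)) :=
    ENNReal.measurable_ofReal.comp (Real.measurable_exp.comp hf)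
  set B : ι → ℕ → Set X := fun i k => hittingSet T Y k ∩ A i with hB
  set a : ι → ℝ≥0∞ := fun i => ENNReal.ofReal (Real.exp (s i) - 1) with ha
  set E : ι → ℝ≥0∞ := fun i => ENNReal.ofReal (Real.exp (s i)) with hE
  set b : ι → ℕ → ℝ≥0∞ := fun i k => ENNReal.ofReal (Real.exp (-(k * s i))) with hb
  set J : ι → ℕ → ℝ≥0∞ := fun i k => ∫⁻ x in B i k, V (T^[k] x) ∂μ with hJ
  set L : ℕ → ℝ≥0∞ := fun n => ENNReal.ofReal (Real.exp q - 1) * ∫⁻ x in Y, V x ∂μ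
    + ∑ i, a i * ∑ k ∈ Finset.range n, b i k * J i k with hL
  set R : ℕ → ℝ≥0∞ := fun n => ENNReal.ofReal (Real.exp q) * μ Y
    + ∑ i, E i * ∑ k ∈ Finset.range n, b i k * μ (B i k) with hR
  -- Replaces `V` at the start of an excursion by `V` at the moment of entering `Y`.
  have hstep : ∀ i k, a i * ∫⁻ x in B i k, V x ∂μ + E i * (b i k * μ (B i k))
      = E i * μ (B i k) + a i * (b i k * J i k) := by
    intro i k
    have h1 : ∫⁻ x in B i k, (a i * V x + E i * b i k) ∂μ
        = ∫⁻ x in B i k, (E i + a i * (b i k * V (T^[k] x))) ∂μ := by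
      refine setLIntegral_congr_fun (h.measB i k) fun x hx => ?_
      exact discountedSum_of_const (hq.le.trans (hqs i))
        fun j hj => hfA i _ (h.iterate_mem hx hj)
    rw [lintegral_add_right _ measurable_const, lintegral_const_mul _ hVm,
      lintegral_add_left measurable_const, setLIntegral_const, setLIntegral_const,
      lintegral_const_mul _ ((hVk k).const_mul _),
      lintegral_const_mul _ (hVk k), mul_assoc] at h1
    exact h1
  -- Integrate `V ∘ T + e^f = V + (e^f - 1) V` over the points hitting `Y` before time `n`, a set of
  -- finite measure, and split it into `Y` and the excursions.
  have hglob : ∀ n, 1 ≤ n → ∫⁻ x in hitBefore T Y n, V (T x) ∂μ + R n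
      = ∫⁻ x in hitBefore T Y n, V x ∂μ + L n := by
    intro n hn
    have h1 : ∫⁻ x in hitBefore T Y n, (V (T x) + ENNReal.ofReal (Real.exp (f x))) ∂μ
        = ∫⁻ x in hitBefore T Y n, (V x + ENNReal.ofReal (Real.exp (f x) - 1) * V x) ∂μ := by
      refine lintegral_congr fun x => ?_
      have h2 := discountedSum_eq (T := T) (f := f) x
      have h3 : 1 + ENNReal.ofReal (Real.exp (f x) - 1) = ENNReal.ofReal (Real.exp (f x)) := by
        rw [← ENNReal.ofReal_one, ← ENNReal.ofReal_add zero_le_one, add_sub_cancel]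
        linarith [Real.add_one_le_exp (f x), hfq x]
      calc V (T x) + ENNReal.ofReal (Real.exp (f x))
          = ENNReal.ofReal (Real.exp (f x)) * V x := by
            rw [hVdef, h2, mul_add, mul_one, ← mul_assoc, ← ENNReal.ofReal_mul (Real.exp_pos _).le,
              ← Real.exp_add, add_neg_cancel, Real.exp_zero, ENNReal.ofReal_one, one_mul, add_comm]
        _ = _ := by rw [← h3, add_mul, one_mul]
    rw [lintegral_add_right _ hEm, lintegral_add_left hVm, h.setLIntegral_hitBefore
      (fun x => ENNReal.ofReal (Real.exp (f x))) hn, h.setLIntegral_hitBefore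
      (fun x => ENNReal.ofReal (Real.exp (f x) - 1) * V x) hn] at h1
    have e1 : ∫⁻ x in Y, ENNReal.ofReal (Real.exp (f x)) ∂μ = ENNReal.ofReal (Real.exp q) * μ Y := by
      rw [← setLIntegral_const]
      exact setLIntegral_congr_fun h.meas fun x hx => by simp only [hfY x hx]
    have e2 : ∫⁻ x in Y, ENNReal.ofReal (Real.exp (f x) - 1) * V x ∂μ
        = ENNReal.ofReal (Real.exp q - 1) * ∫⁻ x in Y, V x ∂μ := by
      rw [← lintegral_const_mul _ hVm]
      exact setLIntegral_congr_fun h.meas fun x hx => by simp only [hfY x hx]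
    have e3 : ∀ i k, ∫⁻ x in hittingSet T Y k ∩ A i, ENNReal.ofReal (Real.exp (f x)) ∂μ
        = E i * μ (B i k) := fun i k => by
      rw [← setLIntegral_const]
      exact setLIntegral_congr_fun (h.measB i k) fun x hx => by simp only [hfA i x hx.2, hE]
    have e4 : ∀ i k, ∫⁻ x in hittingSet T Y k ∩ A i, ENNReal.ofReal (Real.exp (f x) - 1) * V x ∂μ
        = a i * ∫⁻ x in B i k, V x ∂μ := fun i k => by
      rw [← lintegral_const_mul _ hVm]
      exact setLIntegral_congr_fun (h.measB i k) fun x hx => by simp only [hfA i x hx.2, ha]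
    simp only [e1, e2, e3, e4] at h1
    have hsum : ∑ i, ∑ k ∈ Finset.range n, a i * ∫⁻ x in B i k, V x ∂μ
        + ∑ i, E i * ∑ k ∈ Finset.range n, b i k * μ (B i k)
        = ∑ i, ∑ k ∈ Finset.range n, E i * μ (B i k)
        + ∑ i, a i * ∑ k ∈ Finset.range n, b i k * J i k := by
      simp only [Finset.mul_sum, ← Finset.sum_add_distrib, hstep]
    have hfin : ∑ i, ∑ k ∈ Finset.range n, E i * μ (B i k) ≠ ∞ :=
      ENNReal.sum_ne_top.2 fun i _ => ENNReal.sum_ne_top.2 fun k _ =>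
        ENNReal.mul_ne_top ENNReal.ofReal_ne_top
          ((h.measure_hittingSet_inter_le i k).trans_lt h.finite.lt_top).ne
    refine (ENNReal.add_left_inj hfin).1 ?_
    simp only [hR, hL]
    calc _ = (∫⁻ x in hitBefore T Y n, V (T x) ∂μ + (ENNReal.ofReal (Real.exp q) * μ Y
          + ∑ i, ∑ k ∈ Finset.range n, E i * μ (B i k)))
          + ∑ i, E i * ∑ k ∈ Finset.range n, b i k * μ (B i k) := by ring
      _ = ∫⁻ x in hitBefore T Y n, V x ∂μ
          + ENNReal.ofReal (Real.exp q - 1) * ∫⁻ x in Y, V x ∂μ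
          + (∑ i, ∑ k ∈ Finset.range n, a i * ∫⁻ x in B i k, V x ∂μ
          + ∑ i, E i * ∑ k ∈ Finset.range n, b i k * μ (B i k)) := by rw [h1]; ring
      _ = _ := by rw [hsum]; ring
  have hfinV : ∀ (g : X → X) n, ∫⁻ x in hitBefore T Y n, V (g x) ∂μ ≠ ∞ := fun g n => by
    refine ((lintegral_mono fun x => hVC (g x)).trans_lt ?_).ne
    rw [setLIntegral_const]
    exact ENNReal.mul_lt_top ENNReal.ofReal_lt_top (h.measure_hitBefore_ne_top n).lt_top
  set ε : ℕ → ℝ≥0∞ := fun n => C * μ (hitBefore T Y n \ T ⁻¹' hitBefore T Y n) with hε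
  have hε0 : Tendsto ε atTop (𝓝 0) := by
    have := ENNReal.Tendsto.const_mul (a := C) h.tendsto_measure_hitBefore_diff
      (Or.inr ENNReal.ofReal_ne_top)
    rwa [mul_zero] at this
  -- By invariance the integrals of `V ∘ T` and `V` agree up to `ε n`; both are finite since `V` is
  -- bounded, so they cancel.
  have hLR : ∀ n, 1 ≤ n → L n ≤ R n + ε n := fun n hn => by
    refine (ENNReal.add_le_add_iff_left (hfinV id n)).1 ?_
    calc _ = ∫⁻ x in hitBefore T Y n, V (T x) ∂μ + R n := (hglob n hn).symm
      _ ≤ (∫⁻ x in hitBefore T Y n, V x ∂μ + ε n) + R n :=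
        add_le_add (h.setLIntegral_comp_le hVm hVC n) le_rfl
      _ = _ := by rw [add_assoc, add_comm (ε n)]; rfl
  have hRL : ∀ n, 1 ≤ n → R n ≤ L n + ε n := fun n hn => by
    refine (ENNReal.add_le_add_iff_left (hfinV T n)).1 ?_
    calc _ = ∫⁻ x in hitBefore T Y n, V x ∂μ + L n := hglob n hn
      _ ≤ (∫⁻ x in hitBefore T Y n, V (T x) ∂μ + ε n) + L n :=
        add_le_add (h.le_setLIntegral_comp hVm hVC n) le_rfl
      _ = _ := by rw [add_assoc, add_comm (ε n)]
  have hlim : ∀ (c : ℝ≥0∞) (e : ι → ℝ≥0∞) (u : ι → ℕ → ℝ≥0∞), (∀ i, e i ≠ ∞) →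
      Tendsto (fun n => c + ∑ i, e i * ∑ k ∈ Finset.range n, b i k * u i k) atTop
        (𝓝 (c + ∑ i, e i * laplaceSum (u i) (s i))) := fun c e u he =>
    tendsto_const_nhds.add (tendsto_finsetSum _ fun i _ =>
      ENNReal.Tendsto.const_mul (ENNReal.tendsto_nat_tsum _) (Or.inr (he i)))
  have hLlim := hlim (ENNReal.ofReal (Real.exp q - 1) * ∫⁻ x in Y, V x ∂μ) a J
    fun i => ENNReal.ofReal_ne_top
  have hRlim := hlim (ENNReal.ofReal (Real.exp q) * μ Y) E (fun i k => μ (B i k))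
    fun i => ENNReal.ofReal_ne_top
  refine le_antisymm ?_ ?_
  · have := hRlim.add hε0
    rw [add_zero] at this
    exact le_of_tendsto_of_tendsto hLlim this (eventually_atTop.2 ⟨1, hLR⟩)
  · have := hLlim.add hε0
    rw [add_zero] at this
    exact le_of_tendsto_of_tendsto hRlim this (eventually_atTop.2 ⟨1, hRL⟩)

end IsSeparating

/-! ### Entrance densities and integrals over excursions. -/

namespace IsSeparating

variable {X ι : Type*} [MeasurableSpace X] {μ : Measure X} {T : X → X} {Y : Set X}
  {A : ι → Set X} (h : IsSeparating μ T Y A)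

include h

theorem aemeasurable_entranceDensity (i : ι) (n : ℕ) :
    AEMeasurable (entranceDensity μ T Y (A i) n) μ := by
  refine AEMeasurable.div_const (Finset.aemeasurable_fun_sum _ fun k _ => ?_) _
  exact aemeasurable_iterate_transferOp
    (measurable_one.indicator (h.measB i k)).aemeasurable k

theorem sum_setLIntegral_le_mul (i : ι) (n : ℕ) {V : X → ℝ≥0∞} (hV : Measurable V) :
    ∑ k ∈ Finset.range n, ∫⁻ x in hittingSet T Y k ∩ A i, V (T^[k] x) ∂μ
      ≤ n * ∫⁻ x in Y, V x ∂μ := by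
  calc _ ≤ ∑ k ∈ Finset.range n, ∫⁻ x in Y, V x ∂μ := by
        refine Finset.sum_le_sum fun k _ => ?_
        rw [← (h.mp.iterate k).setLIntegral_comp_preimage h.meas hV]
        exact lintegral_mono_set fun x hx => (mem_hittingSet.1 hx.1).1
    _ = _ := by simp

variable [SigmaFinite μ]

theorem lintegral_sum_transferOp_mul (i : ι) (n : ℕ) {V : X → ℝ≥0∞} (hV : Measurable V) :
    ∫⁻ x, (∑ k ∈ Finset.range n,
        (transferOp μ T)^[k] ((hittingSet T Y k ∩ A i).indicator 1) x) * V x ∂μ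
      = ∑ k ∈ Finset.range n, ∫⁻ x in hittingSet T Y k ∩ A i, V (T^[k] x) ∂μ := by
  have hm : ∀ k, AEMeasurable ((hittingSet T Y k ∩ A i).indicator (1 : X → ℝ≥0∞)) μ := fun k =>
    (measurable_one.indicator (h.measB i k)).aemeasurable
  simp_rw [Finset.sum_mul]
  have hmV : ∀ k, AEMeasurable (fun x => (transferOp μ T)^[k]
      ((hittingSet T Y k ∩ A i).indicator (1 : X → ℝ≥0∞)) x * V x) μ := fun k =>
    (aemeasurable_iterate_transferOp (hm k) k).mul hV.aemeasurable
  rw [lintegral_finsetSum' _ fun k _ => hmV k]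
  refine Finset.sum_congr rfl fun k _ => ?_
  rw [lintegral_iterate_transferOp_mul h.mp (hm k) k hV, ← lintegral_indicator (h.measB i k)]
  refine lintegral_congr fun x => ?_
  by_cases hx : x ∈ hittingSet T Y k ∩ A i
  · rw [Set.indicator_of_mem hx, Set.indicator_of_mem hx, Pi.one_apply, one_mul]
  · rw [Set.indicator_of_notMem hx, Set.indicator_of_notMem hx, zero_mul]

theorem sum_setLIntegral_le_of_entranceDensity_le (i : ι) (n : ℕ) {M : ℝ}
    (hbdd : ∀ᵐ x ∂μ, (entranceDensity μ T Y (A i) n x).toReal ≤ M)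
    {V : X → ℝ≥0∞} (hV : Measurable V) :
    ∑ k ∈ Finset.range n, ∫⁻ x in hittingSet T Y k ∩ A i, V (T^[k] x) ∂μ
      ≤ ENNReal.ofReal M * wanderingRate μ T Y (A i) n * ∫⁻ x in Y, V x ∂μ := by
  by_cases hw0 : wanderingRate μ T Y (A i) n = 0
  · rw [hw0, mul_zero, zero_mul]
    rw [h.wanderingRate_eq, Finset.sum_eq_zero_iff] at hw0
    exact (Finset.sum_eq_zero fun k hk => setLIntegral_measure_zero _ _ (hw0 k hk)).le
  set w := wanderingRate μ T Y (A i) n with hw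
  have hwt : w ≠ ∞ := h.wanderingRate_ne_top i n
  have hnum : ∀ x, ∑ k ∈ Finset.range n,
      (transferOp μ T)^[k] ((hittingSet T Y k ∩ A i).indicator 1) x
      = w * entranceDensity μ T Y (A i) n x := fun x => by
    rw [entranceDensity, ← hw, ENNReal.mul_div_cancel hw0 hwt]
  -- Needed because `toReal` sends `∞` to `0`. The numerator of the density has integral `w`, which
  -- is finite.
  have hfin : ∀ᵐ x ∂μ, entranceDensity μ T Y (A i) n x < ∞ := by
    refine ae_lt_top' (h.aemeasurable_entranceDensity i n) fun htop => ?_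
    have h1 := h.lintegral_sum_transferOp_mul i n (V := 1) measurable_one
    simp only [hnum, Pi.one_apply, mul_one, setLIntegral_one] at h1
    rw [lintegral_const_mul'' _ (h.aemeasurable_entranceDensity i n), htop,
      ENNReal.mul_top hw0, ← h.wanderingRate_eq] at h1
    exact hwt h1.symm
  -- Here `T^k x ∈ Y`, so `V` may be cut off outside `Y`.
  have h2 : ∑ k ∈ Finset.range n, ∫⁻ x in hittingSet T Y k ∩ A i, V (T^[k] x) ∂μ
      = ∑ k ∈ Finset.range n, ∫⁻ x in hittingSet T Y k ∩ A i, Y.indicator V (T^[k] x) ∂μ := by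
    refine Finset.sum_congr rfl fun k _ => setLIntegral_congr_fun (h.measB i k) fun x hx => ?_
    simp only [Set.indicator_of_mem (mem_hittingSet.1 hx.1).1]
  rw [h2, ← h.lintegral_sum_transferOp_mul i n (hV.indicator h.meas), ← lintegral_indicator h.meas,
    ← lintegral_const_mul _ (hV.indicator h.meas)]
  refine lintegral_mono_ae ?_
  filter_upwards [hbdd, hfin] with x hx hx'
  rw [hnum, mul_comm w]
  gcongr
  rw [← ENNReal.ofReal_toReal hx'.ne]
  exact ENNReal.ofReal_le_ofReal hx

/-- Bounded entrance densities give upper bounds for integrals over excursions. -/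
theorem exists_sum_setLIntegral_le (i : ι) {M : ℝ}
    (hbdd : ∀ᶠ n in atTop, ∀ᵐ x ∂μ, (entranceDensity μ T Y (A i) n x).toReal ≤ M) :
    ∃ M' : ℝ≥0∞, M' ≠ ∞ ∧ ∃ D : ℝ≥0∞, D ≠ ∞ ∧ ∀ n, ∀ V : X → ℝ≥0∞, Measurable V →
      ∑ k ∈ Finset.range n, ∫⁻ x in hittingSet T Y k ∩ A i, V (T^[k] x) ∂μ
        ≤ (M' * wanderingRate μ T Y (A i) n + D) * ∫⁻ x in Y, V x ∂μ := by
  obtain ⟨N, hN⟩ := eventually_atTop.1 hbdd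
  -- The additive constant `N` covers the finitely many `n ≤ N` by the trivial bound.
  refine ⟨ENNReal.ofReal M, ENNReal.ofReal_ne_top, N, ENNReal.natCast_ne_top N,
    fun n V hV => ?_⟩
  rcases le_total N n with hn | hn
  · refine (h.sum_setLIntegral_le_of_entranceDensity_le i n (hN n hn) hV).trans ?_
    gcongr
    exact le_self_add
  · refine (h.sum_setLIntegral_le_mul i n hV).trans ?_
    gcongr
    exact le_add_left (by exact_mod_cast hn)

/-- Uniform sweeping by the entrance densities gives lower bounds for integrals over
excursions. -/
theorem wanderingRate_mul_le (i : ι) (n : ℕ) {C : ℝ≥0∞} {K : ℕ}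
    (hsw : ∀ᵐ x ∂μ, Y.indicator 1 x ≤ C * ∑ k ∈ Finset.range (K + 1),
      (transferOp μ T)^[k] (entranceDensity μ T Y (A i) n) x)
    {V : X → ℝ≥0∞} (hV : Measurable V)
    (hVT : ∀ (k : ℕ) x, V (T^[k] x) ≤ ENNReal.ofReal (Real.exp k) * V x) :
    wanderingRate μ T Y (A i) n * ∫⁻ x in Y, V x ∂μ
      ≤ C * ((K + 1 : ℕ) * ENNReal.ofReal (Real.exp K)) *
        ∑ k ∈ Finset.range n, ∫⁻ x in hittingSet T Y k ∩ A i, V (T^[k] x) ∂μ := by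
  have hm := h.aemeasurable_entranceDensity i n
  have hmV : AEMeasurable (fun x => entranceDensity μ T Y (A i) n x * V x) μ :=
    hm.mul hV.aemeasurable
  set w := wanderingRate μ T Y (A i) n with hw
  set e := entranceDensity μ T Y (A i) n with he
  have h1 : ∫⁻ x in Y, V x ∂μ ≤ C * ∑ k ∈ Finset.range (K + 1), ∫⁻ x, e x * V (T^[k] x) ∂μ := by
    refine le_trans (le_of_eq ?_) (lintegral_mul_le_of_sweeping h.mp hm hsw hV)
    rw [← lintegral_indicator h.meas]
    refine lintegral_congr fun x => ?_
    by_cases hx : x ∈ Y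
    · rw [Set.indicator_of_mem hx, Set.indicator_of_mem hx, Pi.one_apply, one_mul]
    · rw [Set.indicator_of_notMem hx, Set.indicator_of_notMem hx, zero_mul]
  have h2 : ∀ k ∈ Finset.range (K + 1), ∫⁻ x, e x * V (T^[k] x) ∂μ
      ≤ ENNReal.ofReal (Real.exp K) * ∫⁻ x, e x * V x ∂μ := by
    intro k hk
    rw [← lintegral_const_mul'' _ hmV]
    refine lintegral_mono fun x => ?_
    have hkK : (k : ℝ) ≤ K := by exact_mod_cast Nat.lt_succ_iff.1 (Finset.mem_range.1 hk)
    calc e x * V (T^[k] x) ≤ e x * (ENNReal.ofReal (Real.exp K) * V x) := by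
          gcongr
          refine (hVT k x).trans ?_
          gcongr
      _ = ENNReal.ofReal (Real.exp K) * (e x * V x) := by ring
  have h3 : w * ∫⁻ x, e x * V x ∂μ
      ≤ ∑ k ∈ Finset.range n, ∫⁻ x in hittingSet T Y k ∩ A i, V (T^[k] x) ∂μ := by
    rw [← h.lintegral_sum_transferOp_mul i n hV,
      ← lintegral_const_mul'' _ hmV]
    refine lintegral_mono fun x => ?_
    rw [← mul_assoc]
    gcongr
    exact ENNReal.mul_div_le
  calc w * ∫⁻ x in Y, V x ∂μ
      ≤ w * (C * ((K + 1 : ℕ) * (ENNReal.ofReal (Real.exp K) * ∫⁻ x, e x * V x ∂μ))) := by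
        gcongr
        refine h1.trans ?_
        gcongr
        refine (Finset.sum_le_card_nsmul _ _ _ h2).trans (le_of_eq ?_)
        rw [Finset.card_range, nsmul_eq_mul]
    _ = C * ((K + 1 : ℕ) * ENNReal.ofReal (Real.exp K)) * (w * ∫⁻ x, e x * V x ∂μ) := by ring
    _ ≤ _ := by gcongr

end IsSeparating

/-! ### Laplace transforms of excursion measures under regularly varying wandering rates. -/

theorem regVar_one_sub {ℓ : ℝ → ℝ} (α : ℝ) {x : ℝ} (hx : 0 < x) :
    regVar ℓ (1 - α) x = x * regVar ℓ (-α) x := by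
  unfold regVar
  rw [sub_eq_add_neg, Real.rpow_add hx, Real.rpow_one, mul_assoc]

theorem SlowlyVarying.exists_regVar_mul_le {ℓ : ℝ → ℝ} (hℓ : SlowlyVarying ℓ) (ρ : ℝ) {r : ℝ}
    (hr : 0 < r) : ∃ C : ℝ≥0∞, C ≠ ∞ ∧ ∀ᶠ x in atTop,
      ENNReal.ofReal (regVar ℓ ρ (r * x)) ≤ C * ENNReal.ofReal (regVar ℓ ρ x) := by
  have hC : (0 : ℝ) ≤ r ^ ρ + 1 := by positivity
  refine ⟨ENNReal.ofReal (r ^ ρ + 1), ENNReal.ofReal_ne_top, ?_⟩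
  filter_upwards [hℓ.eventually_regVar_le ρ hr (lt_add_one _)] with x hx
  rw [← ENNReal.ofReal_mul hC]
  exact ENNReal.ofReal_le_ofReal hx

/-- The weighted indicator function `∑ᵢ lamᵢ 1_{Aᵢ}`. -/
noncomputable def weight {X ι : Type*} [Fintype ι] (A : ι → Set X) (lam : ι → ℝ) (x : X) : ℝ :=
  ∑ i, lam i * (A i).indicator (fun _ => (1 : ℝ)) x

theorem weight_nonneg {X ι : Type*} [Fintype ι] {A : ι → Set X} {lam : ι → ℝ}
    (hlam : ∀ i, 0 ≤ lam i) (x : X) : 0 ≤ weight A lam x :=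
  Finset.sum_nonneg fun i _ => mul_nonneg (hlam i) (Set.indicator_nonneg (by simp) x)

namespace IsSeparating

variable {X ι : Type*} [MeasurableSpace X] {μ : Measure X} {T : X → X} {Y : Set X}
  {A : ι → Set X} (h : IsSeparating μ T Y A)

include h

theorem wanderingRate_mono (i : ι) : Monotone (wanderingRate μ T Y (A i)) := fun m n hmn => by
  rw [h.wanderingRate_eq, h.wanderingRate_eq]
  exact Finset.sum_le_sum_of_subset (Finset.range_mono hmn)

section Weight

variable [Fintype ι]

theorem weight_of_mem_Y (lam : ι → ℝ) {x : X} (hx : x ∈ Y) : weight A lam x = 0 := by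
  refine Finset.sum_eq_zero fun i _ => ?_
  rw [Set.indicator_of_notMem (Set.disjoint_left.1 (h.disj i) hx), mul_zero]

theorem weight_of_mem_A (lam : ι → ℝ) {i : ι} {x : X} (hx : x ∈ A i) :
    weight A lam x = lam i := by
  unfold weight
  rw [Finset.sum_eq_single i, Set.indicator_of_mem hx, mul_one]
  · intro j _ hj
    rw [Set.indicator_of_notMem (Set.disjoint_left.1 (h.pairwise hj.symm) hx), mul_zero]
  · simp

theorem measurable_weight (lam : ι → ℝ) : Measurable (weight A lam) :=
  Finset.measurable_fun_sum _ fun i _ =>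
    (measurable_const.indicator (h.meas' i)).const_mul _

theorem weight_le {lam : ι → ℝ} {Λ : ℝ} (hΛ0 : 0 ≤ Λ) (hΛ : ∀ i, lam i ≤ Λ) (x : X) :
    weight A lam x ≤ Λ := by
  rcases (h.cover ▸ Set.mem_univ x : x ∈ Y ∪ ⋃ i, A i) with hx | hx
  · rwa [h.weight_of_mem_Y lam hx]
  · obtain ⟨i, hi⟩ := Set.mem_iUnion.1 hx
    rw [h.weight_of_mem_A lam hi]
    exact hΛ i

end Weight

section Asymptotics

variable {ℓ : ℝ → ℝ} (hℓ : SlowlyVarying ℓ) {α : ℝ} (hα : α ∈ Set.Ioo (0 : ℝ) 1)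
  {β : ℝ} (hβ : 0 < β) {i : ι}
  (hw : (fun n => (wanderingRate μ T Y (A i) n).toReal) ~[atTop]
    fun n : ℕ => β * (n : ℝ) ^ (1 - α) * ℓ n)

include hℓ hα hβ hw

theorem exists_wanderingRate_bounds : ∃ C : ℝ≥0∞, C ≠ ∞ ∧ ∀ᶠ x in atTop,
    wanderingRate μ T Y (A i) ⌊x⌋₊ ≤ C * ENNReal.ofReal (regVar ℓ (1 - α) x) ∧
    ENNReal.ofReal (regVar ℓ (1 - α) x) ≤ C * wanderingRate μ T Y (A i) ⌊x⌋₊ := by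
  obtain ⟨κ, hκ, hev⟩ := hℓ.exists_floor_bounds (by linarith [hα.2]) (by linarith [hα.1])
    (h.wanderingRate_ne_top i) hβ hw
  refine ⟨ENNReal.ofReal κ, ENNReal.ofReal_ne_top, ?_⟩
  filter_upwards [hev] with x hx
  rw [← ENNReal.ofReal_mul hκ.le]
  exact hx

/-- The wandering rate is nondecreasing and eventually positive, and it is comparable to `x^{1-α}
ℓ(x)`. This lets bounded terms such as `μ Y` be absorbed. -/
theorem exists_one_le_regVar : ∃ C : ℝ≥0∞, C ≠ ∞ ∧ ∀ᶠ x in atTop,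
    1 ≤ C * ENNReal.ofReal (regVar ℓ (1 - α) x) := by
  obtain ⟨C, hC, hev⟩ := h.exists_wanderingRate_bounds hℓ hα hβ hw
  obtain ⟨x₀, hx₀⟩ := eventually_atTop.1 (hev.and (eventually_gt_atTop 0))
  have hw0 : wanderingRate μ T Y (A i) ⌊x₀⌋₊ ≠ 0 := fun h0 => by
    have h1 := (hx₀ x₀ le_rfl).1.2
    rw [h0, mul_zero, nonpos_iff_eq_zero, ENNReal.ofReal_eq_zero] at h1
    exact absurd (hℓ.regVar_pos (1 - α) (hx₀ x₀ le_rfl).2) h1.not_gt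
  refine ⟨(wanderingRate μ T Y (A i) ⌊x₀⌋₊)⁻¹ * C,
    ENNReal.mul_ne_top (ENNReal.inv_ne_top.2 hw0) hC, ?_⟩
  filter_upwards [eventually_ge_atTop x₀] with x hx
  rw [mul_assoc, ← ENNReal.inv_mul_cancel hw0 (h.wanderingRate_ne_top i _)]
  gcongr
  exact (h.wanderingRate_mono i (Nat.floor_le_floor hx)).trans (hx₀ x hx).1.1

theorem exists_mul_laplaceSum_le {F : ℝ} (hF : 0 < F) : ∃ C : ℝ≥0∞, C ≠ ∞ ∧ ∀ᶠ y in atTop,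
    ∀ s, 0 < s → s ≤ F / y →
      ENNReal.ofReal s * laplaceSum (fun k => μ (hittingSet T Y k ∩ A i)) s
        ≤ C * ENNReal.ofReal (regVar ℓ (-α) y) := by
  obtain ⟨C, hC, hev⟩ := h.exists_wanderingRate_bounds hℓ hα hβ hw
  obtain ⟨C', hC', hev'⟩ := hℓ.exists_regVar_mul_le (1 - α) (inv_pos.2 hF)
  refine ⟨ENNReal.ofReal (7 * F) * (C * C'),
    ENNReal.mul_ne_top ENNReal.ofReal_ne_top (ENNReal.mul_ne_top hC hC'), ?_⟩
  have ht : Tendsto (fun y : ℝ => F⁻¹ * y) atTop atTop :=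
    tendsto_id.const_mul_atTop (inv_pos.2 hF)
  filter_upwards [ht.eventually hev, hev', eventually_ge_atTop (2 * F), eventually_gt_atTop 0]
    with y hy hy' hyF hy0 s hs hsF
  have h1 := mul_laplaceSum_le (p := fun k => μ (hittingSet T Y k ∩ A i))
    (fun j k => h.measure_hittingSet_inter_anti i) hs hsF
    (by rw [div_le_div_iff₀ hy0 two_pos]; linarith)
  rw [← h.wanderingRate_eq, show 1 / (F / y) = F⁻¹ * y by field_simp] at h1
  calc _ ≤ ENNReal.ofReal (7 * (F / y)) * (C * (C' * ENNReal.ofReal (regVar ℓ (1 - α) y))) := by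
        refine h1.trans ?_
        gcongr
        refine hy.1.trans ?_
        gcongr
    _ = ENNReal.ofReal (7 * (F / y)) * ENNReal.ofReal (regVar ℓ (1 - α) y) * (C * C') := by ring
    _ = _ := by
        rw [← ENNReal.ofReal_mul (by positivity), regVar_one_sub α hy0,
          show 7 * (F / y) * (y * regVar ℓ (-α) y) = 7 * F * regVar ℓ (-α) y by field_simp,
          ENNReal.ofReal_mul (by positivity)]
        ring

theorem exists_laplaceSum_le : ∃ C : ℝ≥0∞, C ≠ ∞ ∧ ∀ᶠ x in atTop,
    laplaceSum (fun k => μ (hittingSet T Y k ∩ A i)) (1 / x)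
      ≤ C * ENNReal.ofReal (regVar ℓ (1 - α) x) := by
  obtain ⟨C, hC, hev⟩ := h.exists_mul_laplaceSum_le hℓ hα hβ hw one_pos
  refine ⟨C, hC, ?_⟩
  filter_upwards [hev, eventually_gt_atTop 0] with x hx hx0
  have h1 := mul_le_mul_right (hx (1 / x) (by positivity) le_rfl) (ENNReal.ofReal x)
  rw [← mul_assoc, ← ENNReal.ofReal_mul hx0.le, mul_one_div_cancel hx0.ne', ENNReal.ofReal_one,
    one_mul] at h1
  rw [regVar_one_sub α hx0, ENNReal.ofReal_mul hx0.le, mul_left_comm]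
  exact h1

theorem exists_le_laplaceSum : ∃ C : ℝ≥0∞, C ≠ ∞ ∧ ∀ᶠ x in atTop,
    ENNReal.ofReal (regVar ℓ (1 - α) x)
      ≤ C * laplaceSum (fun k => μ (hittingSet T Y k ∩ A i)) (1 / x) := by
  obtain ⟨C, hC, hev⟩ := h.exists_wanderingRate_bounds hℓ hα hβ hw
  refine ⟨C * ENNReal.ofReal (Real.exp 1), ENNReal.mul_ne_top hC ENNReal.ofReal_ne_top, ?_⟩
  filter_upwards [hev, eventually_gt_atTop 0] with x hx hx0
  have h1 := sum_range_le_laplaceSum (fun k => μ (hittingSet T Y k ∩ A i))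
    (s := 1 / x) (by positivity) (n := ⌊x⌋₊) (by
      rw [mul_one_div, div_le_one hx0]
      exact Nat.floor_le hx0.le)
  rw [← h.wanderingRate_eq] at h1
  have h2 := mul_le_mul_right h1 (ENNReal.ofReal (Real.exp 1))
  rw [← mul_assoc, ← ENNReal.ofReal_mul (Real.exp_pos _).le, ← Real.exp_add, add_neg_cancel,
    Real.exp_zero, ENNReal.ofReal_one, one_mul] at h2
  refine hx.2.trans ?_
  rw [mul_assoc]
  gcongr

end Asymptotics

end IsSeparating

theorem exists_uniform_const {ι : Type*} [Finite ι] {F : Filter ℝ} {P : ι → ℝ≥0∞ → ℝ → Prop}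
    (hmono : ∀ i C C' x, C ≤ C' → P i C x → P i C' x)
    (hP : ∀ i, ∃ C : ℝ≥0∞, C ≠ ∞ ∧ ∀ᶠ x in F, P i C x) :
    ∃ C : ℝ≥0∞, C ≠ ∞ ∧ ∀ᶠ x in F, ∀ i, P i C x := by
  have := Fintype.ofFinite ι
  choose C hC hev using hP
  refine ⟨∑ i, C i, ENNReal.sum_ne_top.2 fun i _ => hC i, ?_⟩
  filter_upwards [eventually_all.2 hev] with x hx i
  exact hmono i _ _ x (Finset.single_le_sum (fun _ _ => zero_le) (Finset.mem_univ i)) (hx i)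

/-! ### Two-sided bounds for the discounted sum on `Y`. -/

namespace IsSeparating

variable {X ι : Type*} [Fintype ι] [MeasurableSpace X] {μ : Measure X} {T : X → X} {Y : Set X}
  {A : ι → Set X} (h : IsSeparating μ T Y A)
  {ℓ : ℝ → ℝ} (hℓ : SlowlyVarying ℓ) {α : ℝ} (hα : α ∈ Set.Ioo (0 : ℝ) 1)
  {β : ι → ℝ} (hβ : ∀ i, 0 < β i)
  (hw : ∀ i, (fun n => (wanderingRate μ T Y (A i) n).toReal) ~[atTop]
    fun n : ℕ => β i * (n : ℝ) ^ (1 - α) * ℓ n)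
  {lam : ι → ℝ} (hlam : ∀ i, 0 ≤ lam i)

include h

theorem discountedSum_weight_identity {x y : ℝ} (hx : 0 < x) (hy : 0 < y)
    (hlam : ∀ i, 0 ≤ lam i) :
    ENNReal.ofReal (Real.exp (1 / x) - 1) *
        ∫⁻ z in Y, discountedSum T (fun z => 1 / x + 1 / y * weight A lam z) z ∂μ
      + ∑ i, ENNReal.ofReal (Real.exp (1 / x + 1 / y * lam i) - 1) * laplaceSum
        (fun k => ∫⁻ z in hittingSet T Y k ∩ A i,
          discountedSum T (fun z => 1 / x + 1 / y * weight A lam z) (T^[k] z) ∂μ)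
        (1 / x + 1 / y * lam i)
    = ENNReal.ofReal (Real.exp (1 / x)) * μ Y
      + ∑ i, ENNReal.ofReal (Real.exp (1 / x + 1 / y * lam i)) *
        laplaceSum (fun k => μ (hittingSet T Y k ∩ A i)) (1 / x + 1 / y * lam i) := by
  have hm : Measurable fun z => 1 / x + 1 / y * weight A lam z :=
    measurable_const.add ((h.measurable_weight lam).const_mul _)
  refine h.discountedSum_identity hm
    (by positivity) (fun i => ?_) (fun z hz => ?_) fun i z hz => ?_
  · have := hlam i
    exact le_add_of_nonneg_right (by positivity)
  · rw [h.weight_of_mem_Y lam hz, mul_zero, add_zero]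
  · rw [h.weight_of_mem_A lam hz]

theorem measurable_discountedSum_weight (x y : ℝ) :
    Measurable (discountedSum T fun z => 1 / x + 1 / y * weight A lam z) :=
  measurable_discountedSum h.measT (measurable_const.add ((h.measurable_weight lam).const_mul _))

include hℓ hα hβ hw hlam

/-- On the left of the identity keep only the excursions into `A i₀`. Their exponent has order `1/y`
because `lam i₀ > 0`, so sweeping bounds this term below by a multiple of `(1/y) w_y ∫_Y V`, where
`w_y` has order `y^{1-α} ℓ(y)`. -/
theorem exists_lintegral_discountedSum_le {i₀ : ι} (hi₀ : 0 < lam i₀) {c : ℝ≥0∞} (hc : c ≠ ∞)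
    (hlow : ∀ᶠ n in atTop, ∀ V : X → ℝ≥0∞, Measurable V →
      (∀ (k : ℕ) x, V (T^[k] x) ≤ ENNReal.ofReal (Real.exp k) * V x) →
      wanderingRate μ T Y (A i₀) n * ∫⁻ x in Y, V x ∂μ ≤ c *
        ∑ k ∈ Finset.range n, ∫⁻ x in hittingSet T Y k ∩ A i₀, V (T^[k] x) ∂μ) :
    ∃ C : ℝ≥0∞, C ≠ ∞ ∧ ∀ᶠ y in atTop, ∀ x ≥ y,
      ENNReal.ofReal (regVar ℓ (-α) y) *
          ∫⁻ z in Y, discountedSum T (fun z => 1 / x + 1 / y * weight A lam z) z ∂μ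
        ≤ C * ENNReal.ofReal (regVar ℓ (1 - α) x) := by
  set Λ := ∑ i, lam i with hΛ
  have hΛ0 : 0 ≤ Λ := Finset.sum_nonneg fun i _ => hlam i
  have hΛi : ∀ i, lam i ≤ Λ := fun i =>
    Finset.single_le_sum (fun j _ => hlam j) (Finset.mem_univ i)
  set F := 1 + lam i₀ with hF
  have hF0 : 0 < F := by positivity
  obtain ⟨C₁, hC₁, hev₁⟩ := exists_uniform_const (fun i C C' x hCC' hP => hP.trans (by gcongr))
    fun i => h.exists_laplaceSum_le hℓ hα (hβ i) (hw i)
  obtain ⟨C₂, hC₂, hev₂⟩ := h.exists_wanderingRate_bounds hℓ hα (hβ i₀) (hw i₀)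
  obtain ⟨C₃, hC₃, hev₃⟩ := hℓ.exists_regVar_mul_le (1 - α) hF0
  obtain ⟨C₄, hC₄, hev₄⟩ := h.exists_one_le_regVar hℓ hα (hβ i₀) (hw i₀)
  have ht : Tendsto (fun y : ℝ => F⁻¹ * y) atTop atTop :=
    tendsto_id.const_mul_atTop (inv_pos.2 hF0)
  set e := ENNReal.ofReal (Real.exp 1) with he
  refine ⟨C₃ * C₂ * c * e * ENNReal.ofReal (1 / lam i₀) *
      (e * (μ Y * C₄) + ∑ _i : ι, e * C₁), ?_, ?_⟩
  · refine ENNReal.mul_ne_top (ENNReal.mul_ne_top (ENNReal.mul_ne_top (ENNReal.mul_ne_top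
      (ENNReal.mul_ne_top hC₃ hC₂) hc) ENNReal.ofReal_ne_top) ENNReal.ofReal_ne_top)
      (ENNReal.add_ne_top.2 ⟨ENNReal.mul_ne_top ENNReal.ofReal_ne_top
        (ENNReal.mul_ne_top h.finite hC₄), ENNReal.sum_ne_top.2 fun i _ =>
          ENNReal.mul_ne_top ENNReal.ofReal_ne_top hC₁⟩)
  filter_upwards [eventually_forall_ge_atTop.2 hev₁, ht.eventually hev₂, ht.eventually hev₃,
    eventually_forall_ge_atTop.2 hev₄, eventually_ge_atTop (1 + Λ), eventually_gt_atTop 0,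
    (tendsto_nat_floor_atTop.comp ht).eventually (eventually_forall_ge_atTop.2 hlow)]
    with y h₁ h₂ h₃ h₄ hyΛ hy0 hlow x hxy
  have hx0 : 0 < x := hy0.trans_le hxy
  have hid := h.discountedSum_weight_identity (lam := lam) hx0 hy0 hlam
  have hVm := h.measurable_discountedSum_weight (lam := lam) x y
  have hxy' : 1 / x ≤ 1 / y := one_div_le_one_div_of_le hy0 hxy
  -- All exponents are at most `1`, so `V ∘ T^k ≤ e^k V`, as the sweeping bound requires.
  have hs1 : ∀ v, v ≤ Λ → 1 / x + 1 / y * v ≤ 1 := fun v hv => by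
    calc 1 / x + 1 / y * v ≤ 1 / y + 1 / y * Λ := by gcongr
      _ = (1 + Λ) / y := by ring
      _ ≤ 1 := (div_le_one hy0).2 hyΛ
  have hVT : ∀ (k : ℕ) z, discountedSum T (fun z => 1 / x + 1 / y * weight A lam z) (T^[k] z)
      ≤ ENNReal.ofReal (Real.exp k) *
        discountedSum T (fun z => 1 / x + 1 / y * weight A lam z) z := fun k z => by
    have := discountedSum_iterate_le (T := T) (f := fun z => 1 / x + 1 / y * weight A lam z)
      (F := 1) (fun z => hs1 _ (h.weight_le hΛ0 hΛi z)) k z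
    rwa [mul_one] at this
  set V := discountedSum T (fun z => 1 / x + 1 / y * weight A lam z)
  set s := 1 / x + 1 / y * lam i₀ with hs
  have hs0 : 0 < s := by positivity
  -- The sum is cut at `⌊1/s⌋`, the scale seen by the transform at `s`; since `x ≥ y`, one has `s ≤
  -- F / y`.
  have hn : ⌊F⁻¹ * y⌋₊ ≤ ⌊1 / s⌋₊ := by
    refine Nat.floor_le_floor ?_
    rw [le_div_iff₀ hs0, inv_mul_eq_div, div_mul_eq_mul_div, div_le_one hF0]
    calc y * s ≤ y * (1 / y + 1 / y * lam i₀) := by rw [hs]; gcongr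
      _ = F := by field_simp; rfl
  have hA := hlow _ hn V hVm hVT
  have hB := sum_range_le_laplaceSum (fun k => ∫⁻ z in hittingSet T Y k ∩ A i₀, V (T^[k] z) ∂μ)
    (s := s) hs0.le (n := ⌊1 / s⌋₊) (by
      have := Nat.floor_le (one_div_pos.2 hs0).le
      rwa [le_div_iff₀ hs0] at this)
  set S := ∑ k ∈ Finset.range ⌊1 / s⌋₊, ∫⁻ z in hittingSet T Y k ∩ A i₀, V (T^[k] z) ∂μ
  set J := laplaceSum (fun k => ∫⁻ z in hittingSet T Y k ∩ A i₀, V (T^[k] z) ∂μ) s with hJ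
  have hS : S ≤ e * J := by
    have h2 := mul_le_mul_right hB e
    rwa [← mul_assoc, he, ← ENNReal.ofReal_mul (Real.exp_pos _).le, ← Real.exp_add,
      add_neg_cancel, Real.exp_zero, ENNReal.ofReal_one, one_mul] at h2
  have hreg : ENNReal.ofReal (regVar ℓ (1 - α) y)
      ≤ C₃ * (C₂ * wanderingRate μ T Y (A i₀) ⌊1 / s⌋₊) := by
    rw [mul_inv_cancel_left₀ hF0.ne'] at h₃
    refine h₃.trans ?_
    gcongr
    refine h₂.2.trans ?_
    gcongr
    exact h.wanderingRate_mono i₀ hn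
  have hy' : ENNReal.ofReal (1 / y)
      ≤ ENNReal.ofReal (1 / lam i₀) * ENNReal.ofReal (Real.exp s - 1) := by
    rw [← ENNReal.ofReal_mul (by positivity)]
    refine ENNReal.ofReal_le_ofReal ?_
    rw [one_div_mul_eq_div, le_div_iff₀ hi₀]
    have := Real.add_one_le_exp s
    have : 0 < 1 / x := by positivity
    linarith
  have hR : ENNReal.ofReal (Real.exp (1 / x)) * μ Y
      + ∑ i, ENNReal.ofReal (Real.exp (1 / x + 1 / y * lam i)) *
        laplaceSum (fun k => μ (hittingSet T Y k ∩ A i)) (1 / x + 1 / y * lam i)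
      ≤ (e * (μ Y * C₄) + ∑ _i : ι, e * C₁) * ENNReal.ofReal (regVar ℓ (1 - α) x) := by
    rw [add_mul, Finset.sum_mul]
    refine add_le_add ?_ (Finset.sum_le_sum fun i _ => ?_)
    · rw [mul_assoc, mul_assoc]
      gcongr
      · have := hs1 0 hΛ0
        rw [mul_zero, add_zero] at this
        exact ENNReal.ofReal_le_ofReal (Real.exp_le_exp.2 this)
      · exact le_mul_of_one_le_right zero_le (h₄ x hxy)
    · rw [mul_assoc]
      gcongr
      · exact ENNReal.ofReal_le_ofReal (Real.exp_le_exp.2 (hs1 _ (hΛi i)))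
      · refine (laplaceSum_anti _ ?_).trans (h₁ x hxy i)
        have := hlam i
        exact le_add_of_nonneg_right (by positivity)
  have hL : ENNReal.ofReal (Real.exp s - 1) * J ≤ ENNReal.ofReal (Real.exp (1 / x)) * μ Y
      + ∑ i, ENNReal.ofReal (Real.exp (1 / x + 1 / y * lam i)) *
        laplaceSum (fun k => μ (hittingSet T Y k ∩ A i)) (1 / x + 1 / y * lam i) := by
    rw [← hid]
    refine le_trans ?_ le_add_self
    exact Finset.single_le_sum (f := fun i => ENNReal.ofReal (Real.exp (1 / x + 1 / y * lam i) - 1)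
      * laplaceSum (fun k => ∫⁻ z in hittingSet T Y k ∩ A i, V (T^[k] z) ∂μ)
        (1 / x + 1 / y * lam i)) (fun _ _ => zero_le) (Finset.mem_univ i₀)
  have hg : ENNReal.ofReal (regVar ℓ (-α) y)
      = ENNReal.ofReal (1 / y) * ENNReal.ofReal (regVar ℓ (1 - α) y) := by
    rw [regVar_one_sub α hy0, ← ENNReal.ofReal_mul (by positivity), ← mul_assoc,
      one_div_mul_cancel hy0.ne', one_mul]
  calc ENNReal.ofReal (regVar ℓ (-α) y) * ∫⁻ z in Y, V z ∂μ
      ≤ (ENNReal.ofReal (1 / lam i₀) * ENNReal.ofReal (Real.exp s - 1))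
        * (C₃ * (C₂ * wanderingRate μ T Y (A i₀) ⌊1 / s⌋₊)) * ∫⁻ z in Y, V z ∂μ := by
        rw [hg]
        gcongr
    _ = C₃ * C₂ * ENNReal.ofReal (1 / lam i₀) * ENNReal.ofReal (Real.exp s - 1)
        * (wanderingRate μ T Y (A i₀) ⌊1 / s⌋₊ * ∫⁻ z in Y, V z ∂μ) := by ring
    _ ≤ C₃ * C₂ * ENNReal.ofReal (1 / lam i₀) * ENNReal.ofReal (Real.exp s - 1)
        * (c * (e * J)) := by
        exact mul_le_mul_right (hA.trans (mul_le_mul_right hS c)) _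
    _ = C₃ * C₂ * c * e * ENNReal.ofReal (1 / lam i₀) * (ENNReal.ofReal (Real.exp s - 1) * J) := by
        ring
    _ ≤ C₃ * C₂ * c * e * ENNReal.ofReal (1 / lam i₀) *
        ((e * (μ Y * C₄) + ∑ _i : ι, e * C₁) * ENNReal.ofReal (regVar ℓ (1 - α) x)) := by
        exact mul_le_mul_right (hL.trans hR) _
    _ = _ := by ring

/-- On the right of the identity keep only `A i₁`: as `lam i₁ = 0`, its exponent is `1/x` and its
term is at least of order `x^{1-α} ℓ(x)`. Every term on the left is at most a constant times `y^{-α}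
ℓ(y) ∫_Y V`. -/
theorem exists_le_lintegral_discountedSum {i₁ : ι} (hi₁ : lam i₁ = 0) {M D : ℝ≥0∞} (hM : M ≠ ∞)
    (hD : D ≠ ∞) (hup : ∀ i n, ∀ V : X → ℝ≥0∞, Measurable V →
      ∑ k ∈ Finset.range n, ∫⁻ x in hittingSet T Y k ∩ A i, V (T^[k] x) ∂μ
        ≤ (M * wanderingRate μ T Y (A i) n + D) * ∫⁻ x in Y, V x ∂μ) :
    ∃ C : ℝ≥0∞, C ≠ ∞ ∧ ∀ᶠ y in atTop, ∀ x ≥ y,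
      ENNReal.ofReal (regVar ℓ (1 - α) x) ≤ C * (ENNReal.ofReal (regVar ℓ (-α) y) *
          ∫⁻ z in Y, discountedSum T (fun z => 1 / x + 1 / y * weight A lam z) z ∂μ) := by
  set Λ := ∑ i, lam i with hΛ
  have hΛ0 : 0 ≤ Λ := Finset.sum_nonneg fun i _ => hlam i
  have hΛi : ∀ i, lam i ≤ Λ := fun i =>
    Finset.single_le_sum (fun j _ => hlam j) (Finset.mem_univ i)
  obtain ⟨C₁, hC₁, hev₁⟩ := h.exists_le_laplaceSum hℓ hα (hβ i₁) (hw i₁)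
  obtain ⟨C₂, hC₂, hev₂⟩ := exists_uniform_const
    (fun i C C' x hCC' hP s hs hs' => (hP s hs hs').trans (by gcongr))
    fun i => h.exists_mul_laplaceSum_le hℓ hα (hβ i) (hw i) (F := 1 + Λ) (by positivity)
  obtain ⟨C₄, hC₄, hev₄⟩ := h.exists_one_le_regVar hℓ hα (hβ i₁) (hw i₁)
  set c : ℝ≥0∞ := ENNReal.ofReal (2 * (1 + Λ)) * C₄ with hc
  have hct : c ≠ ∞ := ENNReal.mul_ne_top ENNReal.ofReal_ne_top hC₄
  refine ⟨C₁ * (c + ∑ _i : ι, (M * (2 * C₂) + c * D)), ?_, ?_⟩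
  · exact ENNReal.mul_ne_top hC₁ (ENNReal.add_ne_top.2 ⟨hct, ENNReal.sum_ne_top.2 fun i _ =>
      ENNReal.add_ne_top.2 ⟨ENNReal.mul_ne_top hM (ENNReal.mul_ne_top ENNReal.ofNat_ne_top hC₂),
        ENNReal.mul_ne_top hct hD⟩⟩)
  filter_upwards [eventually_forall_ge_atTop.2 hev₁, hev₂, hev₄, eventually_ge_atTop (1 + Λ),
    eventually_gt_atTop 0] with y h₁ h₂ h₄ hyΛ hy0 x hxy
  have hx0 : 0 < x := hy0.trans_le hxy
  have hid := h.discountedSum_weight_identity (lam := lam) hx0 hy0 hlam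
  have hVm := h.measurable_discountedSum_weight (lam := lam) x y
  have hxy' : 1 / x ≤ 1 / y := one_div_le_one_div_of_le hy0 hxy
  set V := discountedSum T (fun z => 1 / x + 1 / y * weight A lam z)
  set I := ∫⁻ z in Y, V z ∂μ
  set g := ENNReal.ofReal (regVar ℓ (-α) y) with hg
  have hgω : ENNReal.ofReal (1 / y) * ENNReal.ofReal (regVar ℓ (1 - α) y) = g := by
    rw [regVar_one_sub α hy0, ← ENNReal.ofReal_mul (by positivity), ← mul_assoc,
      one_div_mul_cancel hy0.ne', one_mul]
  have hsle : ∀ v, v ≤ Λ → 1 / x + 1 / y * v ≤ (1 + Λ) / y := fun v hv => by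
    calc 1 / x + 1 / y * v ≤ 1 / y + 1 / y * Λ := by gcongr
      _ = (1 + Λ) / y := by ring
  have hΛy : (1 + Λ) / y ≤ 1 := (div_le_one hy0).2 hyΛ
  have hexp : ∀ s, 0 ≤ s → s ≤ (1 + Λ) / y → ENNReal.ofReal (Real.exp s - 1)
      ≤ ENNReal.ofReal (2 * s) := fun s hs0 hs => by
    refine ENNReal.ofReal_le_ofReal ?_
    have := Real.abs_exp_sub_one_le (x := s) (by rw [abs_of_nonneg hs0]; linarith)
    rw [abs_of_nonneg hs0] at this
    exact (le_abs_self _).trans this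
  -- `1/y` is at most a constant times `g`, because `y^{1-α} ℓ(y)` is bounded below.
  have hexp' : ∀ s, 0 ≤ s → s ≤ (1 + Λ) / y → ENNReal.ofReal (Real.exp s - 1) ≤ c * g :=
    fun s hs0 hs => by
    calc ENNReal.ofReal (Real.exp s - 1) ≤ ENNReal.ofReal (2 * s) := hexp s hs0 hs
      _ ≤ ENNReal.ofReal (2 * (1 + Λ)) * ENNReal.ofReal (1 / y) := by
        rw [← ENNReal.ofReal_mul (by positivity)]
        refine ENNReal.ofReal_le_ofReal ?_
        rw [mul_assoc, mul_one_div]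
        gcongr
      _ ≤ ENNReal.ofReal (2 * (1 + Λ)) * ENNReal.ofReal (1 / y) *
          (C₄ * ENNReal.ofReal (regVar ℓ (1 - α) y)) := le_mul_of_one_le_right zero_le h₄
      _ = c * g := by rw [← hgω, hc]; ring
  have hJ : ∀ i, ENNReal.ofReal (Real.exp (1 / x + 1 / y * lam i) - 1) * laplaceSum
      (fun k => ∫⁻ z in hittingSet T Y k ∩ A i, V (T^[k] z) ∂μ) (1 / x + 1 / y * lam i)
      ≤ (M * (2 * C₂) + c * D) * (g * I) := by
    intro i
    have hli := hlam i
    set s := 1 / x + 1 / y * lam i with hs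
    have hs0 : 0 < s := by positivity
    have hsΛ := hsle _ (hΛi i)
    have hJ1 := laplaceSum_le_of_sum_range_le
      (b := fun k => ∫⁻ z in hittingSet T Y k ∩ A i, V (T^[k] z) ∂μ)
      (p := fun k => μ (hittingSet T Y k ∩ A i)) (M := M * I) (D := D * I) (fun n => by
        refine (hup i n V hVm).trans (le_of_eq ?_)
        rw [h.wanderingRate_eq]
        ring) hs0
    set Q := laplaceSum (fun k => μ (hittingSet T Y k ∩ A i)) s
    calc _ ≤ ENNReal.ofReal (Real.exp s - 1) * (M * I * Q + D * I) := by gcongr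
      _ = M * I * (ENNReal.ofReal (Real.exp s - 1) * Q)
          + ENNReal.ofReal (Real.exp s - 1) * (D * I) := by ring
      _ ≤ M * I * (2 * (C₂ * g)) + c * g * (D * I) := by
          refine add_le_add (mul_le_mul_right ?_ _) (mul_le_mul_left (hexp' s hs0.le hsΛ) _)
          calc _ ≤ ENNReal.ofReal (2 * s) * Q := mul_le_mul_left (hexp s hs0.le hsΛ) _
            _ = 2 * (ENNReal.ofReal s * Q) := by
                rw [ENNReal.ofReal_mul zero_le_two, ENNReal.ofReal_ofNat, mul_assoc]
            _ ≤ _ := mul_le_mul_right (h₂ i s hs0 hsΛ) _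
      _ = _ := by ring
  have hR : laplaceSum (fun k => μ (hittingSet T Y k ∩ A i₁)) (1 / x)
      ≤ ENNReal.ofReal (Real.exp (1 / x)) * μ Y
      + ∑ i, ENNReal.ofReal (Real.exp (1 / x + 1 / y * lam i)) *
        laplaceSum (fun k => μ (hittingSet T Y k ∩ A i)) (1 / x + 1 / y * lam i) := by
    refine le_trans ?_ le_add_self
    refine le_trans ?_ (Finset.single_le_sum (f := fun i =>
      ENNReal.ofReal (Real.exp (1 / x + 1 / y * lam i)) *
        laplaceSum (fun k => μ (hittingSet T Y k ∩ A i)) (1 / x + 1 / y * lam i))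
      (fun _ _ => zero_le) (Finset.mem_univ i₁))
    simp only [hi₁, mul_zero, add_zero]
    exact le_mul_of_one_le_left zero_le
      (ENNReal.one_le_ofReal.2 (Real.one_le_exp (by positivity)))
  calc ENNReal.ofReal (regVar ℓ (1 - α) x)
      ≤ C₁ * laplaceSum (fun k => μ (hittingSet T Y k ∩ A i₁)) (1 / x) := h₁ x hxy
    _ ≤ C₁ * (c * g * I + ∑ _i : ι, (M * (2 * C₂) + c * D) * (g * I)) := by
        gcongr
        refine (hR.trans hid.symm.le).trans ?_
        refine add_le_add (mul_le_mul_left (hexp' _ (by positivity) ?_) _)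
          (Finset.sum_le_sum fun i _ => hJ i)
        have := hsle 0 hΛ0
        rwa [mul_zero, add_zero] at this
    _ = _ := by rw [← Finset.sum_mul]; ring

end IsSeparating

/-! ### Inversion of Laplace transforms by monotonicity. -/

theorem mul_le_exp_mul_laplaceSum {u : ℕ → ℝ≥0∞} (hu : Antitone u) {n : ℕ} (hn : 0 < n) :
    n * u n ≤ ENNReal.ofReal (Real.exp 1) * laplaceSum u (1 / n) := by
  have hn0 : (n : ℝ) ≠ 0 := by positivity
  have h1 := sum_range_le_laplaceSum u (s := 1 / n) (by positivity) (n := n)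
    (by rw [mul_one_div_cancel hn0])
  have h2 : n * u n ≤ ∑ k ∈ Finset.range n, u k := by
    have := Finset.card_nsmul_le_sum (Finset.range n) u (u n)
      fun k hk => hu (Finset.mem_range.1 hk).le
    simpa using this
  have h3 := mul_le_mul_right h1 (ENNReal.ofReal (Real.exp 1))
  rw [← mul_assoc, ← ENNReal.ofReal_mul (Real.exp_pos _).le, ← Real.exp_add, add_neg_cancel,
    Real.exp_zero, ENNReal.ofReal_one, one_mul] at h3
  exact h2.trans h3

/-- Cut at `n`: the head is controlled by the transform at `1/n`, the tail by `u n` times a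
geometric series of size at most `2bn`. A large transform at the longer scale `bn` thus forces `u n`
to be large. -/
theorem laplaceSum_le_add {u : ℕ → ℝ≥0∞} (hu : Antitone u) {n : ℕ} (hn : 0 < n) {b : ℝ}
    (hb : 1 ≤ b) :
    laplaceSum u (1 / (b * n)) ≤ ENNReal.ofReal (Real.exp 1) * laplaceSum u (1 / n)
      + ENNReal.ofReal (2 * b * n) * u n := by
  have hn0 : (0 : ℝ) < n := by positivity
  have hn1 : (1 : ℝ) ≤ n := by exact_mod_cast hn
  have hb0 : 0 < b := by linarith
  set s := 1 / (b * n) with hs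
  have hs0 : 0 < s := by positivity
  have hs1 : s ≤ 1 := by
    rw [hs, div_le_one (by positivity)]
    nlinarith
  have h1 := sum_range_le_laplaceSum u (s := 1 / n) (by positivity) (n := n)
    (by rw [mul_one_div_cancel hn0.ne'])
  have h3 := mul_le_mul_right h1 (ENNReal.ofReal (Real.exp 1))
  rw [← mul_assoc, ← ENNReal.ofReal_mul (Real.exp_pos _).le, ← Real.exp_add, add_neg_cancel,
    Real.exp_zero, ENNReal.ofReal_one, one_mul] at h3
  have hexp : s / 2 ≤ 1 - Real.exp (-s) := half_le_one_sub_exp_neg hs0.le hs1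
  have htail : ∑' j : ℕ, ENNReal.ofReal (Real.exp (-((n + j : ℕ) * s)))
      ≤ ENNReal.ofReal (2 * b * n) := by
    rw [tsum_exp_geometric hs0]
    refine ENNReal.ofReal_le_ofReal ?_
    rw [div_le_iff₀ (by linarith)]
    have h4 : Real.exp (-(n * s)) ≤ 1 :=
      Real.exp_le_one_iff.2 (by simp only [Left.neg_nonpos_iff]; positivity)
    calc Real.exp (-(n * s)) ≤ 2 * b * n * (s / 2) := by
          rw [hs]
          field_simp
          rw [hs] at h4
          convert h4 using 2
          field_simp
      _ ≤ _ := by gcongr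
  refine le_trans ?_ (add_le_add h3 (mul_le_mul_left htail _))
  rw [← ENNReal.tsum_mul_right]
  conv_lhs => rw [laplaceSum, ← Summable.sum_add_tsum_nat_add' (k := n) (f := fun k : ℕ =>
      ENNReal.ofReal (Real.exp (-(k * s))) * u k) ENNReal.summable]
  refine add_le_add (Finset.sum_le_sum fun k hk => ?_) (ENNReal.tsum_le_tsum fun j => ?_)
  · refine mul_le_of_le_one_left zero_le (ENNReal.ofReal_le_one.2 ?_)
    exact Real.exp_le_one_iff.2 (by simp only [Left.neg_nonpos_iff]; positivity)
  · rw [add_comm n j]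
    exact mul_le_mul_right (hu (by omega)) _

section Inversion

variable {ℓ : ℝ → ℝ} (hℓ : SlowlyVarying ℓ) {α : ℝ}

include hℓ

/-- From two-sided bounds for Laplace transforms of monotone sequences to bounds for the
sequences themselves. -/
theorem exists_bounds_of_laplaceSum_bounds (hα : α ∈ Set.Ioo (0 : ℝ) 1) {u : ℝ → ℕ → ℝ≥0∞}
    (hu : ∀ᶠ y in atTop, Antitone (u y))
    {C₁ C₂ : ℝ≥0∞} (hC₁ : C₁ ≠ ∞) (hC₂ : C₂ ≠ ∞)
    (hup : ∀ᶠ y in atTop, ∀ x ≥ y, ENNReal.ofReal (regVar ℓ (-α) y) * laplaceSum (u y) (1 / x)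
      ≤ C₁ * ENNReal.ofReal (regVar ℓ (1 - α) x))
    (hlow : ∀ᶠ y in atTop, ∀ x ≥ y, ENNReal.ofReal (regVar ℓ (1 - α) x)
      ≤ C₂ * (ENNReal.ofReal (regVar ℓ (-α) y) * laplaceSum (u y) (1 / x))) :
    ∃ C : ℝ≥0∞, C ≠ ∞ ∧ ∀ᶠ y : ℝ in atTop, ∀ n : ℕ, y ≤ n →
      ENNReal.ofReal (regVar ℓ (-α) y) * u y n ≤ C * ENNReal.ofReal (regVar ℓ (-α) n) ∧
      ENNReal.ofReal (regVar ℓ (-α) n) ≤ C * (ENNReal.ofReal (regVar ℓ (-α) y) * u y n) := by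
  set e := ENNReal.ofReal (Real.exp 1) with he
  set B : ℝ := (C₂ * (e * C₁)).toReal + 1 with hB
  have hB1 : C₂ * (e * C₁) + 1 = ENNReal.ofReal B := by
    rw [hB, ENNReal.ofReal_add ENNReal.toReal_nonneg zero_le_one, ENNReal.ofReal_one,
      ENNReal.ofReal_toReal (ENNReal.mul_ne_top hC₂ (ENNReal.mul_ne_top ENNReal.ofReal_ne_top hC₁))]
  have hB0 : 0 ≤ B := add_nonneg ENNReal.toReal_nonneg zero_le_one
  -- Passing from `n` to `bn` multiplies `x^{1-α} ℓ(x)` by more than `B = C₂ e C₁ + 1`: the part `C₂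
  -- e C₁` pays for the head of the transform and `1` remains.
  obtain ⟨b, hb1, hbB⟩ : ∃ b : ℝ, 1 ≤ b ∧ B < b ^ (1 - α) :=
    ((eventually_ge_atTop 1).and ((tendsto_rpow_atTop (by linarith [hα.2])).eventually_gt_atTop
      B)).exists
  have hb0 : 0 < b := by linarith
  refine ⟨max (e * C₁) (C₂ * ENNReal.ofReal (2 * b)), ?_, ?_⟩
  · exact (max_lt (ENNReal.mul_lt_top ENNReal.ofReal_lt_top hC₁.lt_top)
      (ENNReal.mul_lt_top hC₂.lt_top ENNReal.ofReal_lt_top)).ne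
  have hreg := eventually_forall_ge_atTop.2 (hℓ.eventually_le_regVar (1 - α) hb0 hbB)
  filter_upwards [hu, hup, hlow, eventually_gt_atTop (0 : ℝ), hreg]
    with y hu hup hlow hy0 hreg n hyn
  have hn0 : (0 : ℝ) < n := hy0.trans_le hyn
  have hn : 0 < n := by exact_mod_cast hn0
  set g := ENNReal.ofReal (regVar ℓ (-α) y)
  have hgn : ENNReal.ofReal (regVar ℓ (1 - α) n) = n * ENNReal.ofReal (regVar ℓ (-α) n) := by
    rw [regVar_one_sub α hn0, ENNReal.ofReal_mul hn0.le, ENNReal.ofReal_natCast]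
  have hnz : (n : ℝ≥0∞) ≠ 0 := by exact_mod_cast hn.ne'
  have hnt : (n : ℝ≥0∞) ≠ ∞ := ENNReal.natCast_ne_top n
  constructor
  · refine le_trans ?_ (mul_le_mul_left (le_max_left _ _) _)
    rw [← ENNReal.mul_le_mul_iff_right hnz hnt]
    calc (n : ℝ≥0∞) * (g * u y n) = g * (n * u y n) := by ring
      _ ≤ g * (e * laplaceSum (u y) (1 / n)) :=
        mul_le_mul_right (mul_le_exp_mul_laplaceSum hu hn) _
      _ = e * (g * laplaceSum (u y) (1 / n)) := by ring
      _ ≤ e * (C₁ * ENNReal.ofReal (regVar ℓ (1 - α) n)) := mul_le_mul_right (hup n hyn) _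
      _ = _ := by rw [hgn]; ring
  · refine le_trans ?_ (mul_le_mul_left (le_max_right _ _) _)
    rw [← ENNReal.mul_le_mul_iff_right hnz hnt, ← hgn]
    have hfin : C₂ * (e * C₁) * ENNReal.ofReal (regVar ℓ (1 - α) n) ≠ ∞ :=
      ENNReal.mul_ne_top (ENNReal.mul_ne_top hC₂ (ENNReal.mul_ne_top ENNReal.ofReal_ne_top hC₁))
        ENNReal.ofReal_ne_top
    rw [← ENNReal.add_le_add_iff_left hfin]
    have hbn : y ≤ b * n := hyn.trans (le_mul_of_one_le_left hn0.le hb1)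
    calc C₂ * (e * C₁) * ENNReal.ofReal (regVar ℓ (1 - α) n) + ENNReal.ofReal (regVar ℓ (1 - α) n)
        = ENNReal.ofReal (B * regVar ℓ (1 - α) n) := by
          rw [ENNReal.ofReal_mul hB0, ← hB1, add_mul, one_mul]
      _ ≤ ENNReal.ofReal (regVar ℓ (1 - α) (b * n)) := ENNReal.ofReal_le_ofReal (hreg n hyn)
      _ ≤ C₂ * (g * laplaceSum (u y) (1 / (b * n))) := hlow _ hbn
      _ ≤ C₂ * (g * (e * laplaceSum (u y) (1 / n) + ENNReal.ofReal (2 * b * n) * u y n)) :=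
        mul_le_mul_right (mul_le_mul_right (laplaceSum_le_add hu hn hb1) _) _
      _ = C₂ * e * (g * laplaceSum (u y) (1 / n))
          + n * (C₂ * ENNReal.ofReal (2 * b) * (g * u y n)) := by
        rw [ENNReal.ofReal_mul (by positivity : (0 : ℝ) ≤ 2 * b), ENNReal.ofReal_natCast]
        ring
      _ ≤ C₂ * e * (C₁ * ENNReal.ofReal (regVar ℓ (1 - α) n))
          + n * (C₂ * ENNReal.ofReal (2 * b) * (g * u y n)) :=
        add_le_add (mul_le_mul_right (hup n hyn) _) le_rfl
      _ = _ := by ring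

/-- Passing from Laplace functionals `u` to distribution functions `P`. -/
theorem exists_bounds_of_laplace_functional_bounds (hα : α < 1) {u P : ℝ → ℕ → ℝ≥0∞} {C : ℝ≥0∞}
    (hC : C ≠ ∞)
    (hPu : ∀ᶠ y in atTop, ∀ n, P y n ≤ ENNReal.ofReal (Real.exp 1) * u y n)
    (huP : ∀ b, 2 ≤ b → ∀ᶠ y in atTop, ∀ n, u (b⁻¹ * y) n
      ≤ P y n + ENNReal.ofReal (Real.exp (-(b / 2))) * u (2 * (b⁻¹ * y)) n)
    (hu : ∀ᶠ y : ℝ in atTop, ∀ n : ℕ, y ≤ n →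
      ENNReal.ofReal (regVar ℓ (-α) y) * u y n ≤ C * ENNReal.ofReal (regVar ℓ (-α) n) ∧
      ENNReal.ofReal (regVar ℓ (-α) n) ≤ C * (ENNReal.ofReal (regVar ℓ (-α) y) * u y n)) :
    ∃ C' : ℝ≥0∞, C' ≠ ∞ ∧ ∀ᶠ y : ℝ in atTop, ∀ n : ℕ, y ≤ n →
      ENNReal.ofReal (regVar ℓ (-α) y) * P y n ≤ C' * ENNReal.ofReal (regVar ℓ (-α) n) ∧
      ENNReal.ofReal (regVar ℓ (-α) n) ≤ C' * (ENNReal.ofReal (regVar ℓ (-α) y) * P y n) := by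
  set e := ENNReal.ofReal (Real.exp 1) with he
  have hlim : Tendsto (fun b : ℝ => 2 * C.toReal * C.toReal * Real.exp (-(b / 2))) atTop
      (𝓝 (2 * C.toReal * C.toReal * 0)) :=
    (Real.tendsto_exp_neg_atTop_nhds_zero.comp
      (tendsto_id.atTop_div_const zero_lt_two)).const_mul _
  rw [mul_zero] at hlim
  -- Chosen so that the contribution of `{S_n > y}` is at most half of the lower bound and can be
  -- absorbed.
  obtain ⟨b, hb2, hb⟩ := ((eventually_ge_atTop 2).and
    (hlim.eventually_lt_const (show (0 : ℝ) < 1 / 2 by norm_num))).exists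
  have hb0 : 0 < b := by linarith
  have hbE : 2 * C * C * ENNReal.ofReal (Real.exp (-(b / 2))) ≤ 2⁻¹ := by
    rw [← ENNReal.ofReal_toReal hC, ← ENNReal.ofReal_ofNat, ← ENNReal.ofReal_mul zero_le_two,
      ← ENNReal.ofReal_mul (by positivity), ← ENNReal.ofReal_mul (by positivity),
      ← ENNReal.ofReal_inv_of_pos zero_lt_two]
    exact ENNReal.ofReal_le_ofReal (by linarith)
  have hinv : 0 < b⁻¹ := inv_pos.2 hb0
  obtain ⟨Cb, hCb, hevb⟩ := hℓ.exists_regVar_mul_le (-α) hinv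
  -- Uses `2^{-α} > 1/2`, that is, `α < 1`.
  have hhalf : ∀ᶠ z in atTop, regVar ℓ (-α) z ≤ 2 * regVar ℓ (-α) (2 * z) := by
    have h2 : (1 / 2 : ℝ) < 2 ^ (-α) := by
      rw [one_div, ← Real.rpow_neg_one]
      exact Real.rpow_lt_rpow_of_exponent_lt one_lt_two (by linarith)
    filter_upwards [hℓ.eventually_le_regVar (-α) zero_lt_two h2] with z hz
    linarith
  have ht : Tendsto (fun y : ℝ => b⁻¹ * y) atTop atTop := tendsto_id.const_mul_atTop hinv
  have ht2 : Tendsto (fun y : ℝ => 2 * (b⁻¹ * y)) atTop atTop := ht.const_mul_atTop zero_lt_two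
  refine ⟨max (e * C) (2 * C * Cb), ?_, ?_⟩
  · exact (max_lt (ENNReal.mul_lt_top ENNReal.ofReal_lt_top hC.lt_top) (ENNReal.mul_lt_top
      (ENNReal.mul_lt_top ENNReal.ofNat_lt_top hC.lt_top) hCb.lt_top)).ne
  filter_upwards [hPu, huP b hb2, hu, ht.eventually hu, ht2.eventually hu, hevb,
    ht.eventually hhalf, eventually_gt_atTop (0 : ℝ)] with y hPu huP hu1 hu2 hu3 hCb hhalf hy0 n hyn
  have hyb : 2 * (b⁻¹ * y) ≤ y := by
    rw [← mul_assoc]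
    refine mul_le_of_le_one_left hy0.le ?_
    rw [← div_eq_mul_inv]
    exact (div_le_one hb0).2 hb2
  have hyb' : b⁻¹ * y ≤ n := by
    have : 0 < b⁻¹ * y := by positivity
    linarith
  constructor
  · refine le_trans ?_ (mul_le_mul_left (le_max_left _ _) _)
    calc _ ≤ ENNReal.ofReal (regVar ℓ (-α) y) * (e * u y n) := mul_le_mul_right (hPu n) _
      _ = e * (ENNReal.ofReal (regVar ℓ (-α) y) * u y n) := by ring
      _ ≤ e * (C * ENNReal.ofReal (regVar ℓ (-α) n)) := mul_le_mul_right (hu1 n hyn).1 _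
      _ = _ := by ring
  · refine le_trans ?_ (mul_le_mul_left (le_max_right _ _) _)
    set gn := ENNReal.ofReal (regVar ℓ (-α) n) with hgn
    have hgt : gn ≠ ∞ := ENNReal.ofReal_ne_top
    set E := ENNReal.ofReal (Real.exp (-(b / 2)))
    set gb := ENNReal.ofReal (regVar ℓ (-α) (b⁻¹ * y))
    have hgb : gb ≤ 2 * ENNReal.ofReal (regVar ℓ (-α) (2 * (b⁻¹ * y))) := by
      rw [← ENNReal.ofReal_ofNat, ← ENNReal.ofReal_mul zero_le_two]
      exact ENNReal.ofReal_le_ofReal hhalf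
    have h1 : gn ≤ C * gb * P y n + 2⁻¹ * gn := by
      calc gn ≤ C * (gb * u (b⁻¹ * y) n) := (hu2 n hyb').2
        _ ≤ C * (gb * (P y n + E * u (2 * (b⁻¹ * y)) n)) :=
          mul_le_mul_right (mul_le_mul_right (huP n) _) _
        _ = C * gb * P y n + C * E * (gb * u (2 * (b⁻¹ * y)) n) := by ring
        _ ≤ C * gb * P y n + C * E * (2 * (C * gn)) := by
          refine add_le_add le_rfl (mul_le_mul_right ?_ _)
          refine (mul_le_mul_left hgb _).trans ?_
          rw [mul_assoc]
          exact mul_le_mul_right (hu3 n (hyb.trans hyn)).1 _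
        _ = C * gb * P y n + 2 * C * C * E * gn := by ring
        _ ≤ _ := add_le_add le_rfl (mul_le_mul_left hbE _)
    have hhalfgn : gn = 2⁻¹ * gn + 2⁻¹ * gn := by
      rw [← add_mul, ENNReal.inv_two_add_inv_two, one_mul]
    have h2 : 2⁻¹ * gn ≤ C * gb * P y n := by
      have hfin : 2⁻¹ * gn ≠ ∞ := ENNReal.mul_ne_top (by simp) hgt
      rw [← ENNReal.add_le_add_iff_right hfin, ← hhalfgn]
      exact h1
    calc gn = 2 * (2⁻¹ * gn) := by
          rw [← mul_assoc, ENNReal.mul_inv_cancel two_ne_zero ENNReal.ofNat_ne_top, one_mul]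
      _ ≤ 2 * (C * gb * P y n) := mul_le_mul_right h2 _
      _ ≤ 2 * (C * (Cb * ENNReal.ofReal (regVar ℓ (-α) y)) * P y n) :=
        mul_le_mul_right (mul_le_mul_left (mul_le_mul_right hCb _) _) _
      _ = _ := by ring

end Inversion

/-! ### Laplace functionals of Birkhoff sums. -/

section BirkhoffWeight

variable {X : Type*} {T : X → X} {r : X → ℝ}

theorem birkhoffSum_mono_nat (hr : ∀ x, 0 ≤ r x) (x : X) : Monotone fun n => birkhoffSum T r n x :=
  monotone_nat_of_le_succ fun n => by
    rw [birkhoffSum_succ]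
    exact le_add_of_nonneg_right (hr _)

theorem measurable_birkhoffSum [MeasurableSpace X] (hT : Measurable T) (hr : Measurable r)
    (n : ℕ) : Measurable (birkhoffSum T r n) :=
  Finset.measurable_fun_sum _ fun k _ => hr.comp (hT.iterate k)

/-- The Laplace functional of the Birkhoff sums `Sₙr` on `Y`. -/
noncomputable def laplaceFunctional [MeasurableSpace X] (μ : Measure X) (T : X → X) (Y : Set X)
    (r : X → ℝ) (y : ℝ) (n : ℕ) : ℝ≥0∞ :=
  ∫⁻ z in Y, ENNReal.ofReal (Real.exp (-(1 / y * birkhoffSum T r n z))) ∂μ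

variable [MeasurableSpace X] {μ : Measure X} {Y : Set X}

theorem laplaceFunctional_antitone (hr : ∀ x, 0 ≤ r x) {y : ℝ} (hy : 0 < y) :
    Antitone (laplaceFunctional μ T Y r y) := fun m n hmn => by
  refine lintegral_mono fun z => ENNReal.ofReal_le_ofReal (Real.exp_le_exp.2 (neg_le_neg ?_))
  exact mul_le_mul_of_nonneg_left (birkhoffSum_mono_nat hr z hmn) (by positivity)

theorem lintegral_discountedSum_eq (hT : Measurable T) (hr : Measurable r) (x y : ℝ) :
    ∫⁻ z in Y, discountedSum T (fun z => 1 / x + 1 / y * r z) z ∂μ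
      = laplaceSum (laplaceFunctional μ T Y r y) (1 / x) := by
  have hm : ∀ n, Measurable fun z =>
      ENNReal.ofReal (Real.exp (-(1 / y * birkhoffSum T r n z))) := fun n =>
    ENNReal.measurable_ofReal.comp (Real.measurable_exp.comp
      ((measurable_birkhoffSum hT hr n).const_mul _).neg)
  have h1 : ∀ z, discountedSum T (fun z => 1 / x + 1 / y * r z) z
      = ∑' n : ℕ, ENNReal.ofReal (Real.exp (-(n * (1 / x)))) *
        ENNReal.ofReal (Real.exp (-(1 / y * birkhoffSum T r n z))) := fun z => by
    refine tsum_congr fun n => ?_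
    rw [← ENNReal.ofReal_mul (Real.exp_pos _).le, ← Real.exp_add]
    congr 2
    simp only [birkhoffSum, Finset.sum_add_distrib, ← Finset.mul_sum, Finset.sum_const,
      Finset.card_range, nsmul_eq_mul]
    ring
  simp_rw [h1]
  rw [lintegral_tsum fun n => ((hm n).const_mul _).aemeasurable]
  refine tsum_congr fun n => ?_
  rw [lintegral_const_mul _ (hm n)]
  rfl

theorem measure_le_exp_mul_laplaceFunctional (hT : Measurable T) (hr : Measurable r)
    {y : ℝ} (hy : 0 < y) (n : ℕ) :
    μ (Y ∩ {z | birkhoffSum T r n z ≤ y})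
      ≤ ENNReal.ofReal (Real.exp 1) * laplaceFunctional μ T Y r y n := by
  have hS := measurableSet_le (measurable_birkhoffSum hT hr n) (measurable_const (a := y))
  have hm : Measurable fun z => ENNReal.ofReal (Real.exp (-(1 / y * birkhoffSum T r n z))) :=
    ENNReal.measurable_ofReal.comp (Real.measurable_exp.comp
      ((measurable_birkhoffSum hT hr n).const_mul _).neg)
  rw [Set.inter_comm, ← Measure.restrict_apply hS, ← lintegral_indicator_one hS, laplaceFunctional,
    ← lintegral_const_mul _ hm]
  refine lintegral_mono fun z => ?_
  by_cases hz : z ∈ {z | birkhoffSum T r n z ≤ y}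
  swap
  · rw [Set.indicator_of_notMem hz]
    exact zero_le
  rw [Set.indicator_of_mem hz]
  rw [← ENNReal.ofReal_mul (Real.exp_pos _).le, ← Real.exp_add, Pi.one_apply,
    ENNReal.one_le_ofReal]
  refine Real.one_le_exp ?_
  have : 1 / y * birkhoffSum T r n z ≤ 1 := by
    rw [one_div_mul_eq_div, div_le_one hy]
    exact hz
  linarith

/-- On `{S_n > y}` split `exp(-b S_n / y)` into two equal factors: one is at most `e^{-b/2}`, the
other is the integrand at scale `2y/b`. -/
theorem laplaceFunctional_le_measure_add (hT : Measurable T) (hr : Measurable r) {y : ℝ}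
    (hy : 0 < y) (hr0 : ∀ x, 0 ≤ r x) {b : ℝ} (hb : 0 < b) (n : ℕ) :
    laplaceFunctional μ T Y r (b⁻¹ * y) n ≤ μ (Y ∩ {z | birkhoffSum T r n z ≤ y})
      + ENNReal.ofReal (Real.exp (-(b / 2))) * laplaceFunctional μ T Y r (2 * (b⁻¹ * y)) n := by
  have hS := measurableSet_le (measurable_birkhoffSum hT hr n) (measurable_const (a := y))
  have hm : Measurable fun z =>
      ENNReal.ofReal (Real.exp (-(1 / (2 * (b⁻¹ * y)) * birkhoffSum T r n z))) :=
    ENNReal.measurable_ofReal.comp (Real.measurable_exp.comp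
      ((measurable_birkhoffSum hT hr n).const_mul _).neg)
  rw [Set.inter_comm, ← Measure.restrict_apply hS, ← lintegral_indicator_one hS, laplaceFunctional,
    laplaceFunctional, ← lintegral_const_mul _ hm, ← lintegral_add_left (measurable_one.indicator hS)]
  refine lintegral_mono fun z => ?_
  have hz0 : 0 ≤ birkhoffSum T r n z := Finset.sum_nonneg fun k _ => hr0 _
  by_cases hz : birkhoffSum T r n z ≤ y
  · refine le_add_right ?_
    rw [Set.indicator_of_mem (show z ∈ {z | birkhoffSum T r n z ≤ y} from hz), Pi.one_apply]
    refine ENNReal.ofReal_le_one.2 (Real.exp_le_one_iff.2 ?_)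
    simp only [Left.neg_nonpos_iff]
    positivity
  · refine le_add_left ?_
    rw [← ENNReal.ofReal_mul (Real.exp_pos _).le, ← Real.exp_add]
    refine ENNReal.ofReal_le_ofReal (Real.exp_le_exp.2 ?_)
    push Not at hz
    have h1 : 1 / (b⁻¹ * y) * birkhoffSum T r n z
        = 2 * (1 / (2 * (b⁻¹ * y)) * birkhoffSum T r n z) := by field_simp
    have h2 : b / 2 ≤ 1 / (2 * (b⁻¹ * y)) * birkhoffSum T r n z := by
      have : 1 / (2 * (b⁻¹ * y)) * y = b / 2 := by field_simp
      rw [← this]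
      gcongr
    linarith

end BirkhoffWeight

/-! ### Transfer between initial densities. -/

section Reduction

variable {X : Type*} {T : X → X} {r : X → ℝ} {Λ : ℝ}

theorem birkhoffSum_le_nsmul (hΛ : ∀ x, r x ≤ Λ) (k : ℕ) (x : X) :
    birkhoffSum T r k x ≤ k * Λ := by
  have := Finset.sum_le_card_nsmul (Finset.range k) (fun j => r (T^[j] x)) Λ fun j _ => hΛ _
  simpa [birkhoffSum] using this

theorem birkhoffSum_le_add_iterate (hr : ∀ x, 0 ≤ r x) (hΛ : ∀ x, r x ≤ Λ) (n k : ℕ) (x : X) :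
    birkhoffSum T r n x ≤ k * Λ + birkhoffSum T r n (T^[k] x) := by
  calc birkhoffSum T r n x ≤ birkhoffSum T r (k + n) x :=
        birkhoffSum_mono_nat hr x (Nat.le_add_left n k)
    _ = birkhoffSum T r k x + birkhoffSum T r n (T^[k] x) := birkhoffSum_add T r k n x
    _ ≤ _ := by
      have := birkhoffSum_le_nsmul (T := T) hΛ k x
      linarith

theorem birkhoffSum_apply_le (hr : ∀ x, 0 ≤ r x) (hΛ : ∀ x, r x ≤ Λ) (n : ℕ) (x : X) :
    birkhoffSum T r n (T x) ≤ birkhoffSum T r n x + Λ := by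
  have h1 := birkhoffSum_succ T r n x
  rw [birkhoffSum_succ'] at h1
  linarith [hr x, hΛ (T^[n] x)]

/-- Shifting time by `k ≤ K` changes the threshold by at most `K Λ`, which is negligible once the
threshold tends to infinity. -/
theorem lintegral_mul_indicator_le_of_sweeping [MeasurableSpace X] {μ : Measure X} [SigmaFinite μ]
    (hT : MeasurePreserving T μ μ) (hrm : Measurable r) (hr : ∀ x, 0 ≤ r x)
    (hΛ : ∀ x, r x ≤ Λ) (hΛ0 : 0 ≤ Λ) {H G : X → ℝ≥0∞} (hH : AEMeasurable H μ) {C : ℝ≥0∞} {K : ℕ}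
    (h : ∀ᵐ x ∂μ, G x ≤ C * ∑ k ∈ Finset.range (K + 1), (transferOp μ T)^[k] H x)
    (n : ℕ) (a : ℝ) :
    ∫⁻ x, G x * {z | birkhoffSum T r n z ≤ a}.indicator 1 x ∂μ
      ≤ C * (K + 1 : ℕ) *
        ∫⁻ x, H x * {z | birkhoffSum T r n z ≤ K * Λ + a}.indicator 1 x ∂μ := by
  have hS := measurableSet_le (measurable_birkhoffSum hT.measurable hrm n)
    (measurable_const (a := a))
  refine (lintegral_mul_le_of_sweeping hT hH h (measurable_one.indicator hS)).trans ?_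
  rw [mul_assoc]
  refine mul_le_mul_right ?_ _
  refine (Finset.sum_le_card_nsmul _ _
    (∫⁻ x, H x * {z | birkhoffSum T r n z ≤ K * Λ + a}.indicator 1 x ∂μ) fun k hk => ?_).trans
    (le_of_eq (by rw [Finset.card_range, nsmul_eq_mul]))
  refine lintegral_mono fun x => mul_le_mul_right ?_ _
  by_cases hx : T^[k] x ∈ {z | birkhoffSum T r n z ≤ a}
  · rw [Set.indicator_of_mem hx, Set.indicator_of_mem, Pi.one_apply, Pi.one_apply]
    have h1 := birkhoffSum_le_add_iterate (T := T) hr hΛ n k x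
    have h2 : (k : ℝ) * Λ ≤ K * Λ := by
      have : (k : ℝ) ≤ K := by exact_mod_cast Nat.lt_succ_iff.1 (Finset.mem_range.1 hk)
      gcongr
    have h3 : birkhoffSum T r n (T^[k] x) ≤ a := hx
    exact h1.trans (add_le_add h2 h3)
  · rw [Set.indicator_of_notMem hx]
    exact zero_le

theorem lintegral_indicator_mul_indicator [MeasurableSpace X] {μ : Measure X} {Y S : Set X}
    (hY : MeasurableSet Y) (hS : MeasurableSet S) :
    ∫⁻ x, Y.indicator (1 : X → ℝ≥0∞) x * S.indicator 1 x ∂μ = μ (Y ∩ S) := by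
  rw [← lintegral_indicator_one (hY.inter hS)]
  refine lintegral_congr fun x => ?_
  rw [Set.inter_indicator_one]
  rfl

theorem densityMeasure_eq_lintegral [MeasurableSpace X] {μ : Measure X} (G : X → ℝ) {S : Set X}
    (hS : MeasurableSet S) :
    densityMeasure μ G S = ∫⁻ x, ENNReal.ofReal (G x) * S.indicator 1 x ∂μ := by
  rw [densityMeasure, withDensity_apply _ hS, ← lintegral_indicator hS]
  refine lintegral_congr fun x => ?_
  by_cases hx : x ∈ S
  · rw [Set.indicator_of_mem hx, Set.indicator_of_mem hx, Pi.one_apply, mul_one]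
  · rw [Set.indicator_of_notMem hx, Set.indicator_of_notMem hx, mul_zero]

/-- Occupation times count from time `1`, whereas Birkhoff sums start at time `0`; hence the base
point `T x`. The appended weight `0` belongs to `A_d`. -/
theorem sum_mul_occupationTime {m : ℕ} (A : Fin (m + 1) → Set X) (lam : Fin m → ℝ) (n : ℕ)
    (x : X) : ∑ i : Fin m, lam i * occupationTime T (A i.castSucc) n x
      = birkhoffSum T (weight A (Fin.snoc (α := fun _ => ℝ) lam 0)) n (T x) := by
  have h1 : ∀ z, weight A (Fin.snoc (α := fun _ => ℝ) lam 0) z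
      = ∑ i : Fin m, lam i * (A i.castSucc).indicator (fun _ => (1 : ℝ)) z := fun z => by
    rw [weight, Fin.sum_univ_castSucc]
    simp
  simp only [birkhoffSum, h1, occupationTime, Finset.mul_sum]
  rw [Finset.sum_comm]
  simp only [← Function.iterate_succ_apply]
  rw [Finset.range_eq_Ico, Finset.sum_Ico_add' (fun k => ∑ i : Fin m, lam i *
    (A i.castSucc).indicator (fun _ => (1 : ℝ)) (T^[k] x)) 0 n 1]
  rfl

end Reduction

/-- Two-sided bounds for the lower deviations started from `Y`. -/
theorem IsSeparating.exists_measure_bounds {X ι : Type*} [Fintype ι] [MeasurableSpace X]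
    {μ : Measure X} {T : X → X} {Y : Set X} {A : ι → Set X} (h : IsSeparating μ T Y A)
    {ℓ : ℝ → ℝ} (hℓ : SlowlyVarying ℓ) {α : ℝ} (hα : α ∈ Set.Ioo (0 : ℝ) 1)
    {β : ι → ℝ} (hβ : ∀ i, 0 < β i)
    (hw : ∀ i, (fun n => (wanderingRate μ T Y (A i) n).toReal) ~[atTop]
      fun n : ℕ => β i * (n : ℝ) ^ (1 - α) * ℓ n)
    {lam : ι → ℝ} (hlam : ∀ i, 0 ≤ lam i)
    {i₀ : ι} (hi₀ : 0 < lam i₀) {c : ℝ≥0∞} (hc : c ≠ ∞)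
    (hlow : ∀ᶠ n in atTop, ∀ V : X → ℝ≥0∞, Measurable V →
      (∀ (k : ℕ) x, V (T^[k] x) ≤ ENNReal.ofReal (Real.exp k) * V x) →
      wanderingRate μ T Y (A i₀) n * ∫⁻ x in Y, V x ∂μ ≤ c *
        ∑ k ∈ Finset.range n, ∫⁻ x in hittingSet T Y k ∩ A i₀, V (T^[k] x) ∂μ)
    {i₁ : ι} (hi₁ : lam i₁ = 0) {M D : ℝ≥0∞} (hM : M ≠ ∞)
    (hD : D ≠ ∞) (hup : ∀ i n, ∀ V : X → ℝ≥0∞, Measurable V →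
      ∑ k ∈ Finset.range n, ∫⁻ x in hittingSet T Y k ∩ A i, V (T^[k] x) ∂μ
        ≤ (M * wanderingRate μ T Y (A i) n + D) * ∫⁻ x in Y, V x ∂μ) :
    ∃ C : ℝ≥0∞, C ≠ ∞ ∧ ∀ᶠ y : ℝ in atTop, ∀ n : ℕ, y ≤ n →
      ENNReal.ofReal (regVar ℓ (-α) y) * μ (Y ∩ {z | birkhoffSum T (weight A lam) n z ≤ y})
        ≤ C * ENNReal.ofReal (regVar ℓ (-α) n) ∧
      ENNReal.ofReal (regVar ℓ (-α) n) ≤ C * (ENNReal.ofReal (regVar ℓ (-α) y) *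
        μ (Y ∩ {z | birkhoffSum T (weight A lam) n z ≤ y})) := by
  have hr0 : ∀ x, 0 ≤ weight A lam x := weight_nonneg hlam
  have hrm := h.measurable_weight lam
  obtain ⟨C₁, hC₁, h₁⟩ := h.exists_lintegral_discountedSum_le hℓ hα hβ hw hlam hi₀ hc hlow
  obtain ⟨C₂, hC₂, h₂⟩ := h.exists_le_lintegral_discountedSum hℓ hα hβ hw hlam hi₁ hM hD hup
  simp only [lintegral_discountedSum_eq h.measT hrm] at h₁ h₂
  obtain ⟨C, hC, h₃⟩ := exists_bounds_of_laplaceSum_bounds hℓ hα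
    (u := laplaceFunctional μ T Y (weight A lam))
    ((eventually_gt_atTop 0).mono fun y hy => laplaceFunctional_antitone hr0 hy) hC₁ hC₂ h₁ h₂
  exact exists_bounds_of_laplace_functional_bounds hℓ hα.2
    (P := fun y n => μ (Y ∩ {z | birkhoffSum T (weight A lam) n z ≤ y})) hC
    ((eventually_gt_atTop 0).mono fun y hy n =>
      measure_le_exp_mul_laplaceFunctional h.measT hrm hy n)
    (fun b hb => (eventually_gt_atTop 0).mono fun y hy n =>
      laplaceFunctional_le_measure_add h.measT hrm hy hr0 (by linarith) n) h₃

theorem SlowlyVarying.ofReal_ratio_mul_eq {ℓ : ℝ → ℝ} (hℓ : SlowlyVarying ℓ) (α : ℝ) {c : ℝ}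
    (hc : 0 < c) {n : ℕ} (hn : 0 < n) :
    ENNReal.ofReal (ℓ (c * n) / (c ^ α * ℓ n)) * ENNReal.ofReal (regVar ℓ (-α) n)
      = ENNReal.ofReal (regVar ℓ (-α) (c * n)) := by
  have hn0 : (0 : ℝ) < n := by exact_mod_cast hn
  have h1 := hℓ.pos _ hn0
  have h2 := hℓ.pos _ (mul_pos hc hn0)
  have h3 := Real.rpow_pos_of_pos hc α
  rw [← ENNReal.ofReal_mul (by positivity)]
  congr 1
  unfold regVar
  rw [Real.mul_rpow hc.le hn0.le, Real.rpow_neg hc.le]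
  field_simp

end InfErgodic

/-- The sets `A_1, …, A_d` are indexed by `Fin (m + 1)`, with `d = m + 1 ≥ 2`; the last one,
`A_d`, is `A (Fin.last m)`, and `A_1, …, A_{d-1}` are `A i.castSucc` for `i : Fin m`. -/
theorem mainTheorem8 {X : Type*} [MeasurableSpace X] (μ : Measure X) [SigmaFinite μ]
    (T : X → X) (m : ℕ) (hm : 1 ≤ m) (Y : Set X) (A : Fin (m + 1) → Set X)
    -- the decomposition of the space
    (hT : InfErgodic.IsCEMPT T μ)
    (hY_meas : MeasurableSet Y) (hA_meas : ∀ i, MeasurableSet (A i))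
    (hcover : Y ∪ ⋃ i, A i = Set.univ)
    (hYA : ∀ i, Disjoint Y (A i)) (hAA : Pairwise fun i j => Disjoint (A i) (A j))
    (hY_pos : 0 < μ Y) (hY_fin : μ Y < ∞) (hA_inf : ∀ i, μ (A i) = ∞)
    (hsep : InfErgodic.DynamicallySeparated T A)
    -- regular variation of the wandering rates
    (α : ℝ) (hα : α ∈ Set.Ioo (0 : ℝ) 1)
    (β : Fin (m + 1) → ℝ) (hβ : ∀ i, β i ∈ Set.Ioo (0 : ℝ) 1) (hβ_sum : ∑ i, β i = 1)
    (ℓ : ℝ → ℝ) (hℓ : InfErgodic.SlowlyVarying ℓ)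
    (hw : ∀ i, (fun n : ℕ => (InfErgodic.wanderingRate μ T Y (A i) n).toReal) ~[atTop]
      fun n : ℕ => β i * (n : ℝ) ^ (1 - α) * ℓ n)
    -- boundedness of the entrance densities from `A_d`
    (hbdd : ∃ M : ℝ, ∀ n, 2 ≤ n → ∀ᵐ x ∂μ,
      InfErgodic.entranceDensity μ T Y (A (Fin.last m)) n x ≤ ENNReal.ofReal M)
    -- uniform sweeping of the entrance densities from `A_1, …, A_{d-1}`
    (hsweep : ∃ N : ℕ, 2 ≤ N ∧ InfErgodic.UniformlySweeping μ T
      {h | ∃ n, N ≤ n ∧ ∃ i : Fin m, h = InfErgodic.entranceDensity μ T Y (A i.castSucc) n}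
      (Y.indicator 1))
    -- convergence of these entrance densities in `L^∞`
    (hconv : ∃ H : Fin m → X → ℝ, ∀ i : Fin m, MemLp (H i) ∞ μ ∧
      Tendsto (fun n => eLpNorm (fun x =>
        (InfErgodic.entranceDensity μ T Y (A i.castSucc) n x).toReal - H i x) ∞ μ)
        atTop (𝓝 0))
    -- the density `G` and the weights
    (G : X → ℝ) (hG_int : Integrable G μ) (hG_nonneg : 0 ≤ᵐ[μ] G)
    (lam : Fin m → ℝ) (hlam : ∀ i, 0 < lam i) :
    (InfErgodic.UniformlySweeping μ T {fun x => ENNReal.ofReal (G x)} (Y.indicator 1) →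
      ∃ C₁ : ℝ, 0 < C₁ ∧ ∀ c : ℕ → ℝ, (∀ n, 0 < c n) → Tendsto c atTop (𝓝 0) →
        Tendsto (fun n => c n * n) atTop atTop →
        ENNReal.ofReal C₁ ≤ liminf (fun n => InfErgodic.normalizedDeviation μ T
          (fun i : Fin m => A i.castSucc) lam α ℓ G c n) atTop) ∧
    (InfErgodic.UniformlySweeping μ T {Y.indicator 1} (fun x => ENNReal.ofReal (G x)) →
      ∃ C₂ : ℝ, 0 < C₂ ∧ ∀ c : ℕ → ℝ, (∀ n, 0 < c n) → Tendsto c atTop (𝓝 0) →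
        Tendsto (fun n => c n * n) atTop atTop →
        limsup (fun n => InfErgodic.normalizedDeviation μ T
          (fun i : Fin m => A i.castSucc) lam α ℓ G c n) atTop ≤ ENNReal.ofReal C₂) := by
  have h : InfErgodic.IsSeparating μ T Y A :=
    ⟨hT, hY_meas, hA_meas, hcover, hYA, hAA, hY_fin.ne, hsep⟩
  have hTm := h.measT
  set lam' : Fin (m + 1) → ℝ := Fin.snoc (α := fun _ => ℝ) lam 0 with hlam'
  have hlam0 : ∀ i, 0 ≤ lam' i := fun i => by
    refine Fin.lastCases ?_ (fun j => ?_) i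
    · simp [hlam']
    · simpa [hlam'] using (hlam j).le
  set r := InfErgodic.weight A lam' with hr
  have hrm : Measurable r := h.measurable_weight lam'
  have hr0 : ∀ x, 0 ≤ r x := InfErgodic.weight_nonneg hlam0
  set Λ := ∑ i, lam' i with hΛdef
  have hΛ0 : 0 ≤ Λ := Finset.sum_nonneg fun i _ => hlam0 i
  have hΛ : ∀ x, r x ≤ Λ := h.weight_le hΛ0 fun i =>
    Finset.single_le_sum (fun j _ => hlam0 j) (Finset.mem_univ i)
  -- bounds for the integrals over excursions
  have hbound : ∀ i, ∃ M : ℝ, ∀ᶠ n in atTop, ∀ᵐ x ∂μ,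
      (InfErgodic.entranceDensity μ T Y (A i) n x).toReal ≤ M := by
    intro i
    refine Fin.lastCases ?_ (fun j => ?_) i
    · obtain ⟨M, hM⟩ := hbdd
      refine ⟨(ENNReal.ofReal M).toReal, eventually_atTop.2 ⟨2, fun n hn => ?_⟩⟩
      filter_upwards [hM n hn] with x hx
      exact ENNReal.toReal_mono ENNReal.ofReal_ne_top hx
    · obtain ⟨H, hH⟩ := hconv
      -- Convergence in `L^∞` puts the density within distance `1` of `H j` for large `n`.
      refine ⟨1 + (eLpNorm (H j) ∞ μ).toReal, ?_⟩
      filter_upwards [(hH j).2.eventually_lt_const one_pos] with n hn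
      have h1 := ae_le_eLpNormEssSup (μ := μ) (f := H j)
      have h2 := ae_le_eLpNormEssSup (μ := μ) (f := fun x =>
        (InfErgodic.entranceDensity μ T Y (A j.castSucc) n x).toReal - H j x)
      rw [← eLpNorm_exponent_top] at h1 h2
      filter_upwards [h1, h2] with x hx1 hx2
      have h3 := ENNReal.toReal_mono (hH j).1.eLpNorm_ne_top hx1
      have h4 := ENNReal.toReal_mono ENNReal.one_ne_top (hx2.trans hn.le)
      rw [toReal_enorm, Real.norm_eq_abs] at h3
      rw [toReal_enorm, Real.norm_eq_abs, ENNReal.toReal_one] at h4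
      have h5 := le_abs_self (H j x)
      have h6 := (abs_le.1 h4).2
      linarith
  choose Mb hMb using hbound
  choose M' hM' D' hD' hup using fun i => h.exists_sum_setLIntegral_le i (hMb i)
  have hup' : ∀ i n, ∀ V : X → ℝ≥0∞, Measurable V →
      ∑ k ∈ Finset.range n, ∫⁻ x in InfErgodic.hittingSet T Y k ∩ A i, V (T^[k] x) ∂μ
        ≤ ((∑ i, M' i) * InfErgodic.wanderingRate μ T Y (A i) n + ∑ i, D' i)
          * ∫⁻ x in Y, V x ∂μ := by
    intro i n V hV
    refine (hup i n V hV).trans (mul_le_mul_left (add_le_add (mul_le_mul_left ?_ _) ?_) _)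
    · exact Finset.single_le_sum (fun _ _ => zero_le) (Finset.mem_univ i)
    · exact Finset.single_le_sum (fun _ _ => zero_le) (Finset.mem_univ i)
  set j₀ : Fin m := ⟨0, hm⟩
  have hlam_pos : 0 < lam' j₀.castSucc := by simpa [hlam'] using hlam j₀
  have hlam_last : lam' (Fin.last m) = 0 := by simp [hlam']
  obtain ⟨N, -, Cs, -, Ks, hsw⟩ := hsweep
  have hlow : ∀ᶠ n in atTop, ∀ V : X → ℝ≥0∞, Measurable V →
      (∀ (k : ℕ) x, V (T^[k] x) ≤ ENNReal.ofReal (Real.exp k) * V x) →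
      InfErgodic.wanderingRate μ T Y (A j₀.castSucc) n * ∫⁻ x in Y, V x ∂μ
        ≤ ENNReal.ofReal Cs * ((Ks + 1 : ℕ) * ENNReal.ofReal (Real.exp Ks)) *
        ∑ k ∈ Finset.range n,
          ∫⁻ x in InfErgodic.hittingSet T Y k ∩ A j₀.castSucc, V (T^[k] x) ∂μ :=
    eventually_atTop.2 ⟨N, fun n hn V hV hVT =>
      h.wanderingRate_mul_le _ n (hsw _ ⟨n, hn, j₀, rfl⟩) hV hVT⟩
  obtain ⟨C, hC, hCev⟩ := h.exists_measure_bounds hℓ hα (fun i => (hβ i).1) hw hlam0 hlam_pos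
    (ENNReal.mul_ne_top ENNReal.ofReal_ne_top
      (ENNReal.mul_ne_top (ENNReal.natCast_ne_top _) ENNReal.ofReal_ne_top)) hlow hlam_last
    (ENNReal.sum_ne_top.2 fun i _ => hM' i) (ENNReal.sum_ne_top.2 fun i _ => hD' i) hup'
  -- comparison of the two kinds of sums
  have hset : ∀ (c : ℕ → ℝ) (n : ℕ), 0 < n → {x | (1 / (n : ℝ)) *
      ∑ i : Fin m, lam i * InfErgodic.occupationTime T (A i.castSucc) n x ≤ c n}
      = {x | birkhoffSum T r n (T x) ≤ c n * n} := fun c n hn => by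
    have hn0 : (0 : ℝ) < n := by exact_mod_cast hn
    ext x
    rw [Set.mem_ofPred_eq, Set.mem_ofPred_eq, InfErgodic.sum_mul_occupationTime,
      one_div_mul_eq_div, div_le_iff₀ hn0]
  have hSm : ∀ n a, MeasurableSet {x | birkhoffSum T r n x ≤ a} := fun n a =>
    measurableSet_le (InfErgodic.measurable_birkhoffSum hTm hrm n) measurable_const
  have hGm : AEMeasurable (fun x => ENNReal.ofReal (G x)) μ :=
    ENNReal.measurable_ofReal.comp_aemeasurable hG_int.aestronglyMeasurable.aemeasurable
  have hYm : AEMeasurable (Y.indicator (1 : X → ℝ≥0∞)) μ :=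
    (measurable_one.indicator hY_meas).aemeasurable
  have hgpos : ∀ n : ℕ, 0 < n → ENNReal.ofReal (InfErgodic.regVar ℓ (-α) n) ≠ 0 := fun n hn => by
    rw [Ne, ENNReal.ofReal_eq_zero, not_le]
    exact hℓ.regVar_pos _ (by exact_mod_cast hn)
  refine ⟨?_, ?_⟩
  · rintro ⟨C₀, -, K, hK⟩
    have hK' := hK _ rfl
    obtain ⟨C₃, hC₃, hev₃⟩ := hℓ.exists_regVar_mul_le (-α) (show (0 : ℝ) < 1 / 2 by norm_num)
    set B : ℝ≥0∞ := C * C₃ * (ENNReal.ofReal C₀ * (K + 1 : ℕ)) with hB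
    have hBt : B ≠ ∞ := ENNReal.mul_ne_top (ENNReal.mul_ne_top hC hC₃)
      (ENNReal.mul_ne_top ENNReal.ofReal_ne_top (ENNReal.natCast_ne_top _))
    refine ⟨1 / (B.toReal + 1), by positivity, fun c hc0 hc hcn => ?_⟩
    refine le_liminf_of_le (by isBoundedDefault) ?_
    -- The bounds on `Y` are used at half the threshold. The other half absorbs `(K + 1) Λ`: `K Λ`
    -- from sweeping, `Λ` from starting at `T x`.
    have hhalf : Tendsto (fun n : ℕ => 1 / 2 * (c n * n)) atTop atTop :=
      hcn.const_mul_atTop (by norm_num)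
    filter_upwards [hcn.eventually hev₃, hhalf.eventually hCev,
      hhalf.eventually_ge_atTop ((K + 1 : ℕ) * Λ), hc.eventually_lt_const one_pos,
      eventually_gt_atTop 0] with n hn₃ hnC hnΛ hc1 hn
    have hn0 : (0 : ℝ) < n := by exact_mod_cast hn
    have hcn0 : 0 < c n * n := mul_pos (hc0 n) hn0
    have hle : 1 / 2 * (c n * n) ≤ n := by
      have : c n * n ≤ 1 * n := by gcongr
      linarith
    have hmain := (hnC n hle).2
    set y := 1 / 2 * (c n * n) with hy
    unfold InfErgodic.normalizedDeviation
    rw [hset c n hn]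
    have hsub : μ (Y ∩ {z | birkhoffSum T r n z ≤ y}) ≤ ENNReal.ofReal C₀ * (K + 1 : ℕ) *
        InfErgodic.densityMeasure μ G {x | birkhoffSum T r n (T x) ≤ c n * n} := by
      rw [← InfErgodic.lintegral_indicator_mul_indicator hY_meas (hSm n y)]
      refine (InfErgodic.lintegral_mul_indicator_le_of_sweeping h.mp hrm hr0 hΛ hΛ0 hGm hK'
        n y).trans (mul_le_mul_right ?_ _)
      rw [← InfErgodic.densityMeasure_eq_lintegral G (hSm n _)]
      refine measure_mono fun x hx => ?_
      have h1 := InfErgodic.birkhoffSum_apply_le (T := T) hr0 hΛ n x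
      have h2 : birkhoffSum T r n x ≤ K * Λ + y := hx
      refine h1.trans ((add_le_add_left h2 Λ).trans ?_)
      push_cast at hnΛ
      linarith
    set P := InfErgodic.densityMeasure μ G {x | birkhoffSum T r n (T x) ≤ c n * n}
    have hratio := hℓ.ofReal_ratio_mul_eq α (hc0 n) hn
    set R := ENNReal.ofReal (ℓ (c n * n) / (c n ^ α * ℓ n))
    set gn := ENNReal.ofReal (InfErgodic.regVar ℓ (-α) n)
    have hfin : gn * 1 ≤ gn * (B * (R * P)) := by
      calc gn * 1 = gn := mul_one gn
        _ ≤ C * (ENNReal.ofReal (InfErgodic.regVar ℓ (-α) y)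
            * μ (Y ∩ {z | birkhoffSum T r n z ≤ y})) := hmain
        _ ≤ C * (C₃ * ENNReal.ofReal (InfErgodic.regVar ℓ (-α) (c n * n))
            * (ENNReal.ofReal C₀ * (K + 1 : ℕ) * P)) :=
          mul_le_mul_right (mul_le_mul' hn₃ hsub) _
        _ = _ := by rw [← hratio, hB]; ring
    rw [ENNReal.mul_le_mul_iff_right (hgpos n hn) ENNReal.ofReal_ne_top] at hfin
    have hB1 : B ≤ ENNReal.ofReal (B.toReal + 1) := by
      refine (ENNReal.ofReal_toReal hBt).symm.le.trans (ENNReal.ofReal_le_ofReal ?_)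
      linarith
    have hBpos : 0 < B.toReal + 1 := by positivity
    calc ENNReal.ofReal (1 / (B.toReal + 1))
        ≤ ENNReal.ofReal (1 / (B.toReal + 1)) * (ENNReal.ofReal (B.toReal + 1) * (R * P)) :=
          le_mul_of_one_le_right zero_le (hfin.trans (mul_le_mul_left hB1 _))
      _ = R * P := by
          rw [← mul_assoc, ← ENNReal.ofReal_mul (by positivity), one_div_mul_cancel hBpos.ne',
            ENNReal.ofReal_one, one_mul]
  · rintro ⟨C₀, -, K, hK⟩
    have hK' := hK _ rfl
    obtain ⟨C₃, hC₃, hev₃⟩ := hℓ.exists_regVar_mul_le (-α) (show (0 : ℝ) < 1 / 2 by norm_num)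
    set B : ℝ≥0∞ := C * C₃ * (ENNReal.ofReal C₀ * (K + 1 : ℕ)) with hB
    have hBt : B ≠ ∞ := ENNReal.mul_ne_top (ENNReal.mul_ne_top hC hC₃)
      (ENNReal.mul_ne_top ENNReal.ofReal_ne_top (ENNReal.natCast_ne_top _))
    refine ⟨B.toReal + 1, by positivity, fun c hc0 hc hcn => ?_⟩
    refine limsup_le_of_le (by isBoundedDefault) ?_
    -- Now the threshold is enlarged, to make room for `(K + 1) Λ`; `c n < 1/2` keeps it below `n`.
    have hdouble : Tendsto (fun n : ℕ => 2 * (c n * n)) atTop atTop :=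
      hcn.const_mul_atTop (by norm_num)
    filter_upwards [hdouble.eventually hev₃, hdouble.eventually hCev,
      hcn.eventually_ge_atTop ((K + 1 : ℕ) * Λ),
      hc.eventually_lt_const (show (0 : ℝ) < 1 / 2 by norm_num),
      eventually_gt_atTop 0] with n hn₃ hnC hnΛ hc1 hn
    have hn0 : (0 : ℝ) < n := by exact_mod_cast hn
    have hle : 2 * (c n * n) ≤ n := by
      have : c n * n ≤ 1 / 2 * n := by gcongr
      linarith
    have hmain := (hnC n hle).1
    rw [show 1 / 2 * (2 * (c n * n)) = c n * n by ring] at hn₃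
    set y := 2 * (c n * n) with hy
    unfold InfErgodic.normalizedDeviation
    rw [hset c n hn]
    have hsub : InfErgodic.densityMeasure μ G {x | birkhoffSum T r n (T x) ≤ c n * n}
        ≤ ENNReal.ofReal C₀ * (K + 1 : ℕ) * μ (Y ∩ {z | birkhoffSum T r n z ≤ y}) := by
      have h1 : {x | birkhoffSum T r n (T x) ≤ c n * n}
          ⊆ {x | birkhoffSum T r n x ≤ Λ + c n * n} := fun x hx => by
        have h1 := InfErgodic.birkhoffSum_le_add_iterate (T := T) hr0 hΛ n 1 x
        rw [Nat.cast_one, one_mul] at h1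
        exact h1.trans (add_le_add_right hx Λ)
      refine (measure_mono h1).trans ?_
      rw [InfErgodic.densityMeasure_eq_lintegral G (hSm n _)]
      refine (InfErgodic.lintegral_mul_indicator_le_of_sweeping h.mp hrm hr0 hΛ hΛ0 hYm hK'
        n _).trans (mul_le_mul_right ?_ _)
      rw [InfErgodic.lintegral_indicator_mul_indicator hY_meas (hSm n _)]
      refine measure_mono (Set.inter_subset_inter_right _ fun x hx => ?_)
      have h2 : birkhoffSum T r n x ≤ K * Λ + (Λ + c n * n) := hx
      refine h2.trans ?_
      push_cast at hnΛ
      linarith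
    set P := InfErgodic.densityMeasure μ G {x | birkhoffSum T r n (T x) ≤ c n * n}
    have hratio := hℓ.ofReal_ratio_mul_eq α (hc0 n) hn
    set R := ENNReal.ofReal (ℓ (c n * n) / (c n ^ α * ℓ n))
    set gn := ENNReal.ofReal (InfErgodic.regVar ℓ (-α) n)
    have hfin : gn * (R * P) ≤ gn * B := by
      calc gn * (R * P) = ENNReal.ofReal (InfErgodic.regVar ℓ (-α) (c n * n)) * P := by
            rw [← hratio]; ring
        _ ≤ C₃ * ENNReal.ofReal (InfErgodic.regVar ℓ (-α) y) *
            (ENNReal.ofReal C₀ * (K + 1 : ℕ) * μ (Y ∩ {z | birkhoffSum T r n z ≤ y})) :=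
          mul_le_mul' hn₃ hsub
        _ = C₃ * (ENNReal.ofReal C₀ * (K + 1 : ℕ)) * (ENNReal.ofReal (InfErgodic.regVar ℓ (-α) y)
            * μ (Y ∩ {z | birkhoffSum T r n z ≤ y})) := by ring
        _ ≤ C₃ * (ENNReal.ofReal C₀ * (K + 1 : ℕ)) * (C * gn) := mul_le_mul_right hmain _
        _ = gn * B := by rw [hB]; ring
    rw [ENNReal.mul_le_mul_iff_right (hgpos n hn) ENNReal.ofReal_ne_top] at hfin
    refine hfin.trans ((ENNReal.ofReal_toReal hBt).symm.le.trans (ENNReal.ofReal_le_ofReal ?_))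
    linarith
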